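/- **Theorem 1.** Let $M$ be a first-order structure with at least two elements, and let $\mathrm{Def}(M)$ be the set of all subsets of the finite Cartesian powers $M^n$ ($n\ge 0$) that are definable with parameters from $M$. Call $A,B\in\mathrm{Def}(M)$ equivalent if there is a bijection $A\to B$ whose graph is definable with parameters, and write $[A]$ for the class of $A$. The classes form a commutative semiring, the Grothendieck semiring of $M$, in which $[A]+[B]=[A\cap B]+[A\cup B]$ for $A,B$ in the same power of $M$ (so that the sum is the class of a disjoint union), $[A]\cdot[B]=[A\times B]$, $0=[\emptyset]$, and $1$ is the class of a point. The Grothendieck ring $K_0(M)$ is the ring of formal differences of this semiring: its elements are differences $a-b$ of elements of the semiring, where $a-b=c-d$ if and only if $a+d+k=c+b+k$ for some element $k$ of the semiring. Then for every positive integer $N$ there is a structure $M$ such that the rings $K_0(M)$ and $(\mathbb{Z}/N\mathbb{Z})[X]$ are isomorphic. In particular, there is a structure whose Grothendieck ring is non-zero and has non-zero characteristic. -/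

import Mathlib

/-! The Grothendieck ring of a first-order structure. -/

namespace ModelK0

open Set FirstOrder

set_option linter.unusedSectionVars false

section GrothendieckRing

/-- The Grothendieck ring of a commutative semiring `S`. Its additive group is the group of
differences of `(S, +)`: formal differences `a - b`, with `a - b = c - d` if and only if
`a + d + k = c + b + k` for some `k`. It is the smallest ring that contains the image of `S` in
which addition has been made cancellative. -/
def GrothendieckRing (S : Type*) [CommSemiring S] : Type _ := Algebra.GrothendieckAddGroup S

namespace GrothendieckRing

variable {S : Type*} [CommSemiring S]

instance : AddCommGroup (GrothendieckRing S) :=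
  inferInstanceAs (AddCommGroup (Algebra.GrothendieckAddGroup S))

/-- The canonical map from a semiring to its Grothendieck ring, as an additive map. -/
def ofAdd : S →+ GrothendieckRing S := Algebra.GrothendieckAddGroup.of

/-- The additive extension of an additive map to an abelian group. -/
noncomputable def liftAdd {G : Type*} [AddCommGroup G] (f : S →+ G) : GrothendieckRing S →+ G :=
  Algebra.GrothendieckAddGroup.lift f

@[simp] theorem liftAdd_ofAdd {G : Type*} [AddCommGroup G] (f : S →+ G) (a : S) :
    liftAdd f (ofAdd a) = f a :=
  DFunLike.congr_fun (Algebra.GrothendieckAddGroup.lift.symm_apply_apply f) a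

theorem ofAdd_eq_iff {a b : S} : (ofAdd a : GrothendieckRing S) = ofAdd b ↔
    ∃ c, a + c = b + c := by
  have h := (AddLocalization.addMonoidOf (⊤ : AddSubmonoid S)).eq_iff_exists (x := a) (y := b)
  refine Iff.trans h ⟨?_, ?_⟩
  · rintro ⟨c, hc⟩
    exact ⟨c, by rw [add_comm a, add_comm b]; exact hc⟩
  · rintro ⟨c, hc⟩
    exact ⟨⟨c, trivial⟩, by rw [add_comm a, add_comm b] at hc; exact hc⟩

theorem exists_sub (x : GrothendieckRing S) : ∃ a b : S, x = ofAdd a - ofAdd b := by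
  obtain ⟨⟨a, b⟩, h⟩ := (AddLocalization.addMonoidOf (⊤ : AddSubmonoid S)).surj x
  exact ⟨a, b, eq_sub_of_add_eq h⟩

/-- Multiplication, as the biadditive extension of the multiplication of `S`. -/
noncomputable def mulHom : GrothendieckRing S →+ GrothendieckRing S →+ GrothendieckRing S :=
  liftAdd
    { toFun := fun a => liftAdd (ofAdd.comp (AddMonoidHom.mulLeft a))
      map_zero' := by
        ext x
        obtain ⟨c, d, rfl⟩ := exists_sub x
        simp
      map_add' := fun a b => by
        ext x
        obtain ⟨c, d, rfl⟩ := exists_sub x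
        simp [add_mul]
        abel }

theorem mulHom_ofAdd (a b : S) : mulHom (ofAdd a) (ofAdd b) = ofAdd (a * b) := by
  simp [mulHom]

noncomputable instance : Mul (GrothendieckRing S) := ⟨fun x y => mulHom x y⟩

noncomputable instance : One (GrothendieckRing S) := ⟨ofAdd 1⟩

theorem mul_def (x y : GrothendieckRing S) : x * y = mulHom x y := rfl

theorem one_def : (1 : GrothendieckRing S) = ofAdd 1 := rfl

theorem mul_comm_aux (x y : GrothendieckRing S) : x * y = y * x := by
  obtain ⟨a, b, rfl⟩ := exists_sub x
  obtain ⟨c, d, rfl⟩ := exists_sub y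
  simp only [mul_def, map_sub, AddMonoidHom.sub_apply, mulHom_ofAdd, mul_comm]
  abel

theorem one_mul_aux (x : GrothendieckRing S) : 1 * x = x := by
  obtain ⟨a, b, rfl⟩ := exists_sub x
  simp only [mul_def, one_def, map_sub, mulHom_ofAdd, one_mul]

noncomputable instance : CommRing (GrothendieckRing S) where
  __ := (inferInstance : AddCommGroup (GrothendieckRing S))
  __ := (inferInstance : Mul (GrothendieckRing S))
  __ := (inferInstance : One (GrothendieckRing S))
  left_distrib x y z := by simp only [mul_def, map_add]
  right_distrib x y z := by simp only [mul_def, map_add, AddMonoidHom.add_apply]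
  zero_mul x := by simp only [mul_def, map_zero, AddMonoidHom.zero_apply]
  mul_zero x := by simp only [mul_def, map_zero]
  mul_assoc x y z := by
    obtain ⟨a, b, rfl⟩ := exists_sub x
    obtain ⟨c, d, rfl⟩ := exists_sub y
    obtain ⟨e, f, rfl⟩ := exists_sub z
    simp only [mul_def, map_sub, AddMonoidHom.sub_apply, mulHom_ofAdd, mul_assoc]
  one_mul := one_mul_aux
  mul_one x := by rw [mul_comm_aux, one_mul_aux]
  mul_comm := mul_comm_aux

/-- The canonical semiring homomorphism from a semiring to its Grothendieck ring. -/
noncomputable def of : S →+* GrothendieckRing S where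
  __ := (ofAdd : S →+ GrothendieckRing S)
  map_one' := rfl
  map_mul' a b := (mulHom_ofAdd a b).symm

end GrothendieckRing

end GrothendieckRing

section Definable

variable (L : FirstOrder.Language.{0, 0}) {M : Type} [L.Structure M] {α β γ δ : Type}

/-- A set is definable with parameters from the structure. -/
abbrev Def (A : Set (α → M)) : Prop := (univ : Set M).Definable L A

/-- There is a definable (with parameters) bijection from `A` onto `B`: a map that is bijective
from `A` to `B` and whose graph over `A` is definable. -/
def DefBij (A : Set (α → M)) (B : Set (β → M)) : Prop :=
  ∃ f : (α → M) → (β → M), BijOn f A B ∧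
    Def L {w : α ⊕ β → M | w ∘ Sum.inl ∈ A ∧ w ∘ Sum.inr = f (w ∘ Sum.inl)}

variable {L}

theorem def_eq_const (i : α) (c : M) : Def L {v : α → M | v i = c} := by
  refine ⟨(FirstOrder.Language.Term.var i).equal (L.con (⟨c, mem_univ c⟩ : (univ : Set M))).term, ?_⟩
  ext v
  simp

theorem def_eq_var (i j : α) : Def L {v : α → M | v i = v j} :=
  ⟨(FirstOrder.Language.Term.var i).equal (FirstOrder.Language.Term.var j), by ext; simp⟩

theorem def_forall [Finite α] {P : α → (β → M) → Prop} (h : ∀ i, Def L {v | P i v}) :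
    Def L {v | ∀ i, P i v} := by
  rw [ofPred_forall]
  exact definable_iInter_of_finite h

/-- Maps each of whose coordinates is a coordinate of the argument or a constant. -/
def coordMap (t : β → α ⊕ M) (v : α → M) : β → M := fun i => Sum.elim v id (t i)

theorem defBij_of_coordMap [Finite β] (t : β → α ⊕ M) {A : Set (α → M)} {B : Set (β → M)}
    (hA : Def L A) (h : BijOn (coordMap t) A B) : DefBij L A B := by
  refine ⟨_, h, ?_⟩
  refine (hA.preimage_comp Sum.inl).inter ?_
  have : {w : α ⊕ β → M | w ∘ Sum.inr = coordMap t (w ∘ Sum.inl)} =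
      {w | ∀ i, w (Sum.inr i) = coordMap t (w ∘ Sum.inl) i} := by
    ext w; simp [funext_iff]
  refine (congrArg (Def L) this).mpr (def_forall fun i => ?_)
  rcases hi : t i with j | c
  · simpa [coordMap, hi] using def_eq_var (L := L) (M := M) (Sum.inr i : α ⊕ β) (Sum.inl j)
  · simpa [coordMap, hi] using def_eq_const (L := L) (Sum.inr i : α ⊕ β) c

theorem DefBij.refl [Finite α] {A : Set (α → M)} (hA : Def L A) : DefBij L A A :=
  defBij_of_coordMap Sum.inl hA (bijOn_id A)

theorem DefBij.symm [Nonempty M] {A : Set (α → M)} {B : Set (β → M)} (h : DefBij L A B) :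
    DefBij L B A := by
  obtain ⟨f, hf, hd⟩ := h
  have hi := hf.invOn_invFunOn
  refine ⟨Function.invFunOn f A, hf.symm hi.symm, ?_⟩
  have := hd.preimage_comp (Sum.swap : α ⊕ β → β ⊕ α)
  refine (congrArg (Def L) ?_).mp this
  ext w
  have e1 : (w ∘ Sum.swap) ∘ (Sum.inl : α → α ⊕ β) = w ∘ Sum.inr := rfl
  have e2 : (w ∘ Sum.swap) ∘ (Sum.inr : β → α ⊕ β) = w ∘ Sum.inl := rfl
  simp only [mem_preimage, mem_ofPred_eq, e1, e2]
  constructor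
  · rintro ⟨h1, h2⟩
    rw [h2]
    exact ⟨hf.mapsTo h1, (hi.1 h1).symm⟩
  · rintro ⟨h1, h2⟩
    rw [h2]
    exact ⟨(hf.symm hi.symm).mapsTo h1, (hi.2 h1).symm⟩

theorem DefBij.trans [Finite α] [Finite β] [Finite γ] {A : Set (α → M)} {B : Set (β → M)}
    {C : Set (γ → M)} (h : DefBij L A B) (h' : DefBij L B C) : DefBij L A C := by
  obtain ⟨f, hf, hd⟩ := h
  obtain ⟨g, hg, hd'⟩ := h'
  refine ⟨g ∘ f, hg.comp hf, ?_⟩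
  have k := ((hd.preimage_comp (Sum.inl : α ⊕ β → (α ⊕ β) ⊕ γ)).inter
    (hd'.preimage_comp (Sum.map Sum.inr id : β ⊕ γ → (α ⊕ β) ⊕ γ))).image_comp
    (Sum.map Sum.inl id : α ⊕ γ → (α ⊕ β) ⊕ γ)
  refine (congrArg (Def L) ?_).mp k
  ext w
  constructor
  · rintro ⟨u, ⟨⟨h1, h2⟩, ⟨h3, h4⟩⟩, rfl⟩
    exact ⟨h1, h4.trans (congrArg g h2)⟩
  · rintro ⟨h1, h2⟩
    refine ⟨Sum.elim (Sum.elim (w ∘ Sum.inl) (f (w ∘ Sum.inl))) (w ∘ Sum.inr),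
      ⟨⟨h1, rfl⟩, ⟨hf.mapsTo h1, h2⟩⟩, ?_⟩
    ext (i | i) <;> rfl

theorem DefBij.union {A A' : Set (α → M)} {B B' : Set (β → M)}
    (h : DefBij L A B) (h' : DefBij L A' B') (hA : Disjoint A A') (hB : Disjoint B B') :
    DefBij L (A ∪ A') (B ∪ B') := by
  classical
  obtain ⟨f, hf, hd⟩ := h
  obtain ⟨g, hg, hd'⟩ := h'
  have ef : EqOn (A.piecewise f g) f A := piecewise_eqOn A f g
  have eg : EqOn (A.piecewise f g) g A' := fun x hx =>
    piecewise_eq_of_notMem A f g (disjoint_right.mp hA hx)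
  have hf' := hf.congr ef.symm
  have hg' := hg.congr eg.symm
  refine ⟨A.piecewise f g, hf'.union hg' ?_, ?_⟩
  · rw [injOn_union hA]
    refine ⟨hf'.injOn, hg'.injOn, fun x hx y hy he => ?_⟩
    exact disjoint_left.mp hB (hf'.mapsTo hx) (he ▸ hg'.mapsTo hy)
  · refine (congrArg (Def L) ?_).mp (hd.union hd')
    ext w
    constructor
    · rintro (⟨h1, h2⟩ | ⟨h1, h2⟩)
      · exact ⟨Or.inl h1, h2.trans (ef h1).symm⟩
      · exact ⟨Or.inr h1, h2.trans (eg h1).symm⟩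
    · rintro ⟨h1 | h1, h2⟩
      · exact Or.inl ⟨h1, h2.trans (ef h1)⟩
      · exact Or.inr ⟨h1, h2.trans (eg h1)⟩

theorem defBij_empty [Nonempty M] : DefBij L (∅ : Set (α → M)) (∅ : Set (β → M)) := by
  refine ⟨fun _ _ => Classical.arbitrary M, bijOn_empty _, ?_⟩
  simp

/-- The Cartesian product of two sets of tuples. -/
def prodSet (A : Set (α → M)) (B : Set (β → M)) : Set (α ⊕ β → M) :=
  {w | w ∘ Sum.inl ∈ A ∧ w ∘ Sum.inr ∈ B}

theorem def_prodSet {A : Set (α → M)} {B : Set (β → M)} (hA : Def L A) (hB : Def L B) :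
    Def L (prodSet A B) :=
  (hA.preimage_comp Sum.inl).inter (hB.preimage_comp Sum.inr)

theorem DefBij.prod {A : Set (α → M)} {B : Set (β → M)} {A' : Set (γ → M)} {B' : Set (δ → M)}
    (h : DefBij L A A') (h' : DefBij L B B') : DefBij L (prodSet A B) (prodSet A' B') := by
  obtain ⟨f, hf, hd⟩ := h
  obtain ⟨g, hg, hd'⟩ := h'
  refine ⟨fun v => Sum.elim (f (v ∘ Sum.inl)) (g (v ∘ Sum.inr)), ⟨?_, ?_, ?_⟩, ?_⟩
  · exact fun v hv => ⟨hf.mapsTo hv.1, hg.mapsTo hv.2⟩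
  · intro v hv w hw e
    have e1 := hf.injOn hv.1 hw.1 (congrArg (· ∘ Sum.inl) e)
    have e2 := hg.injOn hv.2 hw.2 (congrArg (· ∘ Sum.inr) e)
    ext (i | i)
    · exact congrFun e1 i
    · exact congrFun e2 i
  · rintro w ⟨h1, h2⟩
    obtain ⟨a, ha, ea⟩ := hf.surjOn h1
    obtain ⟨b, hb, eb⟩ := hg.surjOn h2
    refine ⟨Sum.elim a b, ⟨ha, hb⟩, ?_⟩
    ext (i | i)
    · exact congrFun ea i
    · exact congrFun eb i
  · refine (congrArg (Def L) ?_).mp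
      ((hd.preimage_comp (Sum.map Sum.inl Sum.inl : α ⊕ γ → (α ⊕ β) ⊕ (γ ⊕ δ))).inter
      (hd'.preimage_comp (Sum.map Sum.inr Sum.inr : β ⊕ δ → (α ⊕ β) ⊕ (γ ⊕ δ))))
    ext w
    constructor
    · rintro ⟨⟨h1, h2⟩, ⟨h3, h4⟩⟩
      refine ⟨⟨h1, h3⟩, ?_⟩
      ext (i | i)
      · exact congrFun h2 i
      · exact congrFun h4 i
    · rintro ⟨⟨h1, h3⟩, h⟩
      exact ⟨⟨h1, congrArg (· ∘ Sum.inl) h⟩, ⟨h3, congrArg (· ∘ Sum.inr) h⟩⟩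

/-! Two distinct points make it possible to move two definable sets into one Cartesian power so
that they become disjoint. -/

variable [Nontrivial M]

variable (M) in
/-- A point. -/
noncomputable def pt₁ : M := (exists_pair_ne M).choose

variable (M) in
/-- A second point. -/
noncomputable def pt₂ : M := (exists_pair_ne M).choose_spec.choose

theorem pt_ne : pt₁ M ≠ pt₂ M := (exists_pair_ne M).choose_spec.choose_spec

/-- The copy `{pt₁} × A × {(pt₁, …, pt₁)}` of `A`. -/
def leftCopy (β : Type) (A : Set (α → M)) : Set (Option (α ⊕ β) → M) :=
  {v | v none = pt₁ M ∧ (fun i => v (some (Sum.inl i))) ∈ A ∧ ∀ j, v (some (Sum.inr j)) = pt₁ M}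

/-- The copy `{pt₂} × {(pt₁, …, pt₁)} × B` of `B`. -/
def rightCopy (α : Type) (B : Set (β → M)) : Set (Option (α ⊕ β) → M) :=
  {v | v none = pt₂ M ∧ (fun i => v (some (Sum.inr i))) ∈ B ∧ ∀ j, v (some (Sum.inl j)) = pt₁ M}

/-- The union of disjoint copies of `A` and `B`. -/
def sumSet (A : Set (α → M)) (B : Set (β → M)) : Set (Option (α ⊕ β) → M) :=
  leftCopy β A ∪ rightCopy α B

theorem disjoint_copies (A : Set (α → M)) (B : Set (β → M)) :
    Disjoint (leftCopy β A) (rightCopy α B) :=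
  disjoint_left.mpr fun _ h h' => pt_ne (h.1.symm.trans h'.1)

theorem disjoint_leftCopy {A B : Set (α → M)} (h : Disjoint A B) :
    Disjoint (leftCopy β A) (leftCopy β B) :=
  disjoint_left.mpr fun _ h1 h2 => disjoint_left.mp h h1.2.1 h2.2.1

theorem disjoint_rightCopy {A B : Set (β → M)} (h : Disjoint A B) :
    Disjoint (rightCopy α A) (rightCopy α B) :=
  disjoint_left.mpr fun _ h1 h2 => disjoint_left.mp h h1.2.1 h2.2.1

theorem leftCopy_union (A B : Set (α → M)) :
    leftCopy β (A ∪ B) = leftCopy β A ∪ leftCopy β B := by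
  ext v; simp only [leftCopy, mem_ofPred_eq, mem_union]; tauto

theorem rightCopy_union (A B : Set (β → M)) :
    rightCopy α (A ∪ B) = rightCopy α A ∪ rightCopy α B := by
  ext v; simp only [rightCopy, mem_ofPred_eq, mem_union]; tauto

section
variable [Finite α] [Finite β] [Finite γ]

theorem def_leftCopy {A : Set (α → M)} (hA : Def L A) : Def L (leftCopy β A) :=
  (def_eq_const _ _).inter ((hA.preimage_comp fun i => some (Sum.inl i)).inter
    (def_forall fun _ => def_eq_const _ _))

theorem def_rightCopy {B : Set (β → M)} (hB : Def L B) : Def L (rightCopy α B) :=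
  (def_eq_const _ _).inter ((hB.preimage_comp fun i => some (Sum.inr i)).inter
    (def_forall fun _ => def_eq_const _ _))

theorem def_sumSet {A : Set (α → M)} {B : Set (β → M)} (hA : Def L A) (hB : Def L B) :
    Def L (sumSet A B) :=
  (def_leftCopy hA).union (def_rightCopy hB)

theorem defBij_leftCopy {A : Set (α → M)} (hA : Def L A) : DefBij L A (leftCopy β A) := by
  refine defBij_of_coordMap
    (fun i => i.elim (Sum.inr (pt₁ M)) (Sum.elim Sum.inl fun _ => Sum.inr (pt₁ M))) hA
    ⟨fun v hv => ?_, fun v _ w _ h => ?_, fun v hv => ?_⟩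
  · exact ⟨rfl, hv, fun _ => rfl⟩
  · ext i; exact congrFun h (some (Sum.inl i))
  · refine ⟨_, hv.2.1, ?_⟩
    ext (_ | i | i)
    · exact hv.1.symm
    · rfl
    · exact (hv.2.2 i).symm

theorem defBij_rightCopy {B : Set (β → M)} (hB : Def L B) : DefBij L B (rightCopy α B) := by
  refine defBij_of_coordMap
    (fun i => i.elim (Sum.inr (pt₂ M)) (Sum.elim (fun _ => Sum.inr (pt₁ M)) Sum.inl)) hB
    ⟨fun v hv => ?_, fun v _ w _ h => ?_, fun v hv => ?_⟩
  · exact ⟨rfl, hv, fun _ => rfl⟩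
  · ext i; exact congrFun h (some (Sum.inr i))
  · refine ⟨_, hv.2.1, ?_⟩
    ext (_ | i | i)
    · exact hv.1.symm
    · exact (hv.2.2 i).symm
    · rfl

/-- A set that is the union of disjoint definable copies of `A` and of `B` represents the sum. -/
theorem sumSet_defBij {A : Set (α → M)} {B : Set (β → M)} {C D : Set (γ → M)}
    (hA : Def L A) (hB : Def L B) (h : DefBij L A C) (h' : DefBij L B D) (hd : Disjoint C D) :
    DefBij L (sumSet A B) (C ∪ D) :=
  ((defBij_leftCopy hA).symm.trans h).union ((defBij_rightCopy hB).symm.trans h')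
    (disjoint_copies A B) hd

end

end Definable

section SemiRing

variable (L : FirstOrder.Language.{0, 0}) (M : Type) [L.Structure M]

/-- The definable (with parameters) subsets of all finite Cartesian powers of `M`. -/
abbrev DefSet : Type := Σ n : ℕ, L.DefinableSet (univ : Set M) (Fin n)

variable [Nontrivial M]

/-- Two definable sets are equivalent if there is a definable bijection between them. -/
instance defSetoid : Setoid (DefSet L M) where
  r A B := DefBij L (A.2 : Set (Fin A.1 → M)) (B.2 : Set (Fin B.1 → M))
  iseqv := ⟨fun A => DefBij.refl A.2.2, DefBij.symm, DefBij.trans⟩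

/-- The Grothendieck semiring: definable sets up to definable bijection. -/
def SemiK0 : Type := Quotient (defSetoid L M)

variable {L M} {α β γ δ : Type} [Finite α] [Finite β] [Finite γ] [Finite δ]

/-- Renaming of coordinates by a bijection of index sets. -/
def reindex {n : ℕ} (e : Fin n ≃ α) (A : Set (α → M)) : Set (Fin n → M) :=
  {v | v ∘ e.symm ∈ A}

theorem def_reindex {n : ℕ} (e : Fin n ≃ α) {A : Set (α → M)} (hA : Def L A) :
    Def L (reindex e A) :=
  hA.preimage_comp e.symm

theorem defBij_reindex {n : ℕ} (e : Fin n ≃ α) {A : Set (α → M)} (hA : Def L A) :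
    DefBij L A (reindex e A) := by
  have h : ∀ v : α → M, (v ∘ e) ∘ e.symm = v := fun v => by ext; simp
  refine defBij_of_coordMap (fun i => Sum.inl (e i)) hA
    ⟨fun v hv => ?_, fun v _ w _ hvw => ?_, fun v hv => ⟨_, hv, ?_⟩⟩
  · change (v ∘ e) ∘ e.symm ∈ A
    rwa [h]
  · rw [← h v, ← h w]
    exact congrArg (· ∘ e.symm) hvw
  · ext i
    simp [coordMap]

/-- The class of a definable set of tuples indexed by any finite type. -/
noncomputable def cls (A : Set (α → M)) (hA : Def L A) : SemiK0 L M :=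
  Quotient.mk _ ⟨Nat.card α, ⟨reindex (Finite.equivFin α).symm A, def_reindex _ hA⟩⟩

theorem cls_eq {A : Set (α → M)} {B : Set (β → M)} {hA : Def L A} {hB : Def L B}
    (h : DefBij L A B) : cls A hA = cls B hB :=
  Quotient.sound (((defBij_reindex _ hA).symm.trans h).trans (defBij_reindex _ hB))

theorem mk_eq_cls (A : DefSet L M) :
    (Quotient.mk _ A : SemiK0 L M) = cls (A.2 : Set (Fin A.1 → M)) A.2.2 :=
  Quotient.sound (defBij_reindex _ A.2.2)

theorem exists_cls (x : SemiK0 L M) :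
    ∃ (n : ℕ) (A : Set (Fin n → M)) (hA : Def L A), x = cls A hA := by
  induction x using Quotient.ind with
  | _ A => exact ⟨A.1, A.2, A.2.2, mk_eq_cls A⟩

theorem DefBij.sum {A : Set (α → M)} {B : Set (β → M)} {A' : Set (γ → M)} {B' : Set (δ → M)}
    (hA : Def L A) (hB : Def L B) (hA' : Def L A') (hB' : Def L B')
    (h : DefBij L A A') (h' : DefBij L B B') : DefBij L (sumSet A B) (sumSet A' B') :=
  sumSet_defBij hA hB (h.trans (defBij_leftCopy hA')) (h'.trans (defBij_rightCopy hB'))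
    (disjoint_copies A' B')

/-- The sum of two classes is the class of a disjoint union. -/
noncomputable instance : Add (SemiK0 L M) where
  add := Quotient.lift₂
    (fun A B : DefSet L M => cls (sumSet (A.2 : Set (Fin A.1 → M)) (B.2 : Set (Fin B.1 → M)))
      (def_sumSet A.2.2 B.2.2))
    (fun A B A₁ B₁ h h₁ => cls_eq (DefBij.sum A.2.2 B.2.2 A₁.2.2 B₁.2.2 h h₁))

/-- The product of two classes is the class of the Cartesian product. -/
noncomputable instance : Mul (SemiK0 L M) where
  mul := Quotient.lift₂
    (fun A B : DefSet L M => cls (prodSet (A.2 : Set (Fin A.1 → M)) (B.2 : Set (Fin B.1 → M)))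
      (def_prodSet A.2.2 B.2.2))
    (fun _ _ _ _ h h₁ => cls_eq (DefBij.prod h h₁))

/-- The class of the empty set. -/
noncomputable instance : Zero (SemiK0 L M) := ⟨cls (∅ : Set (Fin 0 → M)) definable_empty⟩

/-- The class of a point, the zeroth Cartesian power of `M`. -/
noncomputable instance : One (SemiK0 L M) := ⟨cls (univ : Set (Fin 0 → M)) definable_univ⟩

theorem cls_empty : cls (∅ : Set (α → M)) definable_empty = (0 : SemiK0 L M) :=
  cls_eq defBij_empty

theorem cls_add {A : Set (α → M)} {B : Set (β → M)} (hA : Def L A) (hB : Def L B) :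
    cls A hA + cls B hB = cls (sumSet A B) (def_sumSet hA hB) :=
  cls_eq (hA := def_sumSet (def_reindex _ hA) (def_reindex _ hB))
    (DefBij.sum (def_reindex _ hA) (def_reindex _ hB) hA hB
    (defBij_reindex _ hA).symm (defBij_reindex _ hB).symm)

theorem cls_mul {A : Set (α → M)} {B : Set (β → M)} (hA : Def L A) (hB : Def L B) :
    cls A hA * cls B hB = cls (prodSet A B) (def_prodSet hA hB) :=
  cls_eq (hA := def_prodSet (def_reindex _ hA) (def_reindex _ hB))
    (DefBij.prod (defBij_reindex _ hA).symm (defBij_reindex _ hB).symm)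

/-- If `A` and `B` are equivalent to disjoint sets `C` and `D`, then `[A] + [B] = [C ∪ D]`. -/
theorem cls_add_eq {A : Set (α → M)} {B : Set (β → M)} {C D : Set (γ → M)}
    (hA : Def L A) (hB : Def L B) (hC : Def L C) (hD : Def L D)
    (h : DefBij L A C) (h' : DefBij L B D) (hd : Disjoint C D) :
    cls A hA + cls B hB = cls (C ∪ D) (hC.union hD) :=
  (cls_add hA hB).trans (cls_eq (sumSet_defBij hA hB h h' hd))

theorem cls_add_of_disjoint {A B : Set (α → M)} (hA : Def L A) (hB : Def L B)
    (hd : Disjoint A B) : cls A hA + cls B hB = cls (A ∪ B) (hA.union hB) :=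
  cls_add_eq hA hB hA hB (.refl hA) (.refl hB) hd

theorem add_assoc_aux (x y z : SemiK0 L M) : x + y + z = x + (y + z) := by
  obtain ⟨m, A, hA, rfl⟩ := exists_cls x
  obtain ⟨n, B, hB, rfl⟩ := exists_cls y
  obtain ⟨k, C, hC, rfl⟩ := exists_cls z
  rw [cls_add hA hB, cls_add hB hC, cls_add, cls_add]
  refine cls_eq ?_
  have e1 : sumSet (sumSet A B) C =
      leftCopy (Fin k) (leftCopy (Fin n) A) ∪
        (leftCopy (Fin k) (rightCopy (Fin m) B) ∪ rightCopy (Option (Fin m ⊕ Fin n)) C) := by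
    rw [sumSet, sumSet, leftCopy_union, union_assoc]
  have e2 : sumSet A (sumSet B C) =
      leftCopy (Option (Fin n ⊕ Fin k)) A ∪
        (rightCopy (Fin m) (leftCopy (Fin k) B) ∪ rightCopy (Fin m) (rightCopy (Fin n) C)) := by
    rw [sumSet, sumSet, rightCopy_union]
  have d1 := disjoint_copies (sumSet A B) C
  have d2 := disjoint_copies A (sumSet B C)
  rw [sumSet, leftCopy_union, disjoint_union_left] at d1
  rw [sumSet, rightCopy_union, disjoint_union_right] at d2
  rw [e1, e2]
  refine DefBij.union ?_ (DefBij.union ?_ ?_ d1.2 (disjoint_rightCopy (disjoint_copies B C)))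
    (disjoint_union_right.mpr ⟨disjoint_leftCopy (disjoint_copies A B), d1.1⟩)
    (disjoint_union_right.mpr d2)
  · exact (((defBij_leftCopy hA).trans (defBij_leftCopy (def_leftCopy hA))).symm).trans
      (defBij_leftCopy hA)
  · exact (((defBij_rightCopy hB).trans (defBij_leftCopy (def_rightCopy hB))).symm).trans
      ((defBij_leftCopy hB).trans (defBij_rightCopy (def_leftCopy hB)))
  · exact ((defBij_rightCopy hC).symm).trans
      ((defBij_rightCopy hC).trans (defBij_rightCopy (def_rightCopy hC)))

theorem add_comm_aux (x y : SemiK0 L M) : x + y = y + x := by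
  obtain ⟨m, A, hA, rfl⟩ := exists_cls x
  obtain ⟨n, B, hB, rfl⟩ := exists_cls y
  rw [cls_add_eq hA hB (def_rightCopy hA) (def_leftCopy hB) (defBij_rightCopy (α := Fin n) hA)
    (defBij_leftCopy (β := Fin m) hB) (disjoint_copies B A).symm, cls_add hB hA]
  congr 1
  exact union_comm _ _

theorem zero_add_aux (x : SemiK0 L M) : 0 + x = x := by
  obtain ⟨n, A, hA, rfl⟩ := exists_cls x
  rw [← cls_empty (α := Fin n), cls_add_of_disjoint _ _ (empty_disjoint A)]
  congr 1
  exact empty_union A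

theorem mul_comm_aux (x y : SemiK0 L M) : x * y = y * x := by
  obtain ⟨m, A, hA, rfl⟩ := exists_cls x
  obtain ⟨n, B, hB, rfl⟩ := exists_cls y
  rw [cls_mul, cls_mul]
  refine cls_eq (defBij_of_coordMap (fun i => Sum.inl i.swap) (def_prodSet hA hB)
    ⟨fun v hv => ?_, fun v _ w _ h => ?_, fun v hv => ?_⟩)
  · exact ⟨hv.2, hv.1⟩
  · ext i
    simpa [coordMap] using congrFun h i.swap
  · refine ⟨v ∘ Sum.swap, ⟨hv.2, hv.1⟩, ?_⟩
    ext i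
    simp [coordMap]

theorem mul_assoc_aux (x y z : SemiK0 L M) : x * y * z = x * (y * z) := by
  obtain ⟨m, A, hA, rfl⟩ := exists_cls x
  obtain ⟨n, B, hB, rfl⟩ := exists_cls y
  obtain ⟨k, C, hC, rfl⟩ := exists_cls z
  rw [cls_mul hA hB, cls_mul hB hC, cls_mul, cls_mul]
  refine cls_eq (defBij_of_coordMap
    (fun i => Sum.inl ((Equiv.sumAssoc (Fin m) (Fin n) (Fin k)).symm i))
    (def_prodSet (def_prodSet hA hB) hC)
    ⟨fun v hv => ⟨hv.1.1, hv.1.2, hv.2⟩, fun v _ w _ h => ?_, fun v hv => ?_⟩)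
  · ext i
    simpa [coordMap] using congrFun h (Equiv.sumAssoc _ _ _ i)
  · refine ⟨v ∘ Equiv.sumAssoc _ _ _, ⟨⟨hv.1, hv.2.1⟩, hv.2.2⟩, ?_⟩
    ext i
    simp [coordMap]

theorem one_mul_aux (x : SemiK0 L M) : 1 * x = x := by
  obtain ⟨n, A, hA, rfl⟩ := exists_cls x
  refine (cls_mul definable_univ hA).trans (cls_eq ?_)
  refine defBij_of_coordMap (fun i => Sum.inl (Sum.inr i)) (def_prodSet definable_univ hA)
    ⟨fun v hv => hv.2, fun v _ w _ h => ?_, fun v hv => ?_⟩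
  · ext (i | i)
    · exact i.elim0
    · exact congrFun h i
  · exact ⟨Sum.elim Fin.elim0 v, ⟨trivial, hv⟩, rfl⟩

theorem zero_mul_aux (x : SemiK0 L M) : 0 * x = 0 := by
  obtain ⟨n, A, hA, rfl⟩ := exists_cls x
  refine (cls_mul definable_empty hA).trans (Eq.trans ?_ (cls_empty (α := Fin 0 ⊕ Fin n)))
  congr 1
  ext v
  simp [prodSet]

theorem mul_add_aux (x y z : SemiK0 L M) : x * (y + z) = x * y + x * z := by
  obtain ⟨m, A, hA, rfl⟩ := exists_cls x
  obtain ⟨n, B, hB, rfl⟩ := exists_cls y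
  obtain ⟨k, C, hC, rfl⟩ := exists_cls z
  have hB' := def_leftCopy (β := Fin k) hB
  have hC' := def_rightCopy (α := Fin n) hC
  rw [cls_add hB hC, cls_mul, cls_mul, cls_mul, cls_add_eq (def_prodSet hA hB) (def_prodSet hA hC)
    (def_prodSet hA hB') (def_prodSet hA hC') (DefBij.prod (.refl hA) (defBij_leftCopy hB))
    (DefBij.prod (.refl hA) (defBij_rightCopy hC))]
  · congr 1
    ext v
    exact and_or_left
  · exact disjoint_left.mpr fun v h h' => disjoint_left.mp (disjoint_copies B C) h.2 h'.2

noncomputable instance : CommSemiring (SemiK0 L M) where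
  add_assoc := add_assoc_aux
  zero_add := zero_add_aux
  add_zero x := by rw [add_comm_aux, zero_add_aux]
  add_comm := add_comm_aux
  nsmul := nsmulRec
  left_distrib := mul_add_aux
  right_distrib x y z := by
    rw [mul_comm_aux, mul_add_aux, mul_comm_aux z x, mul_comm_aux z y]
  zero_mul := zero_mul_aux
  mul_zero x := by rw [mul_comm_aux, zero_mul_aux]
  mul_assoc := mul_assoc_aux
  one_mul := one_mul_aux
  mul_one x := by rw [mul_comm_aux, one_mul_aux]
  mul_comm := mul_comm_aux

/-- The addition of the semiring is the one with `[A] + [B] = [A ∩ B] + [A ∪ B]`. -/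
theorem cls_add_cls {A B : Set (α → M)} (hA : Def L A) (hB : Def L B) :
    cls A hA + cls B hB = cls (A ∩ B) (hA.inter hB) + cls (A ∪ B) (hA.union hB) := by
  have h1 : cls B hB = cls (A ∩ B) (hA.inter hB) + cls (B \ A) (hB.sdiff hA) := by
    rw [cls_add_of_disjoint _ _ (disjoint_left.mpr fun v h h' => h'.2 h.1)]
    congr 1
    rw [inter_comm, inter_union_sdiff]
  have h2 : cls (A ∪ B) (hA.union hB) = cls A hA + cls (B \ A) (hB.sdiff hA) := by
    rw [cls_add_of_disjoint _ _ disjoint_sdiff_right]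
    congr 1
    rw [union_sdiff_self]
  rw [h1, h2, add_left_comm]

variable (L M) in
/-- The Grothendieck ring of the structure `M`. It is considered for structures with at least two
elements, since in the powers of a one-element structure there are no two disjoint non-empty
sets, so that a sum of two classes need not be the class of a definable set. -/
abbrev K0 : Type := GrothendieckRing (SemiK0 L M)

end SemiRing

end ModelK0

/-!
The structure is `M = (ℕ, x ↦ x + N)`, with the graph of the translation as its only relation, and
the class of `M` corresponds to the variable `X`. The translation is a definable bijection from `M`
onto the complement of `N` points, so that `N = 0` in `K₀(M)` and there is a homomorphism `polyHom`
from `(ℤ/N)[X]` to `K₀(M)` that sends `X` to `[M]`. It is shown to be bijective.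

Definable sets are controlled by a semantic quantifier elimination (`isLocal_mem`): for each of them
there is a bound `K` such that membership of a tuple depends only on its entries below `K` and on
the differences of its entries that are multiples of `N` of absolute value at most `K`. A set or a
function with this property is called local. If two tuples have the same local data with respect to
`2 * K`, a permutation of `ℕ` matches the possible further entries with respect to `K`
(`LocEq.exists_perm`). Hence applying any permutation-invariant operation to the last variable keeps
a function local. This covers quantifiers and integrals alike.

Injectivity comes from an Euler characteristic with values in `(ℤ/N)[X]`. Eventually constant
functions on `ℕ` are integrated against the finitely additive measure with value `1` on points and
`X` on `ℕ`, and the Euler characteristic of a definable set is the iterated integral of its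
indicator function. For local functions the order of integration may be changed (`iint_comm`). The
one case with content is the graph of a translation by `N * k`: its projections are `ℕ` and `ℕ`
without `N * k` points, and these have the same measure because `N = 0` in `(ℤ/N)[X]`. Integrating
the indicator function of the graph of a definable bijection in both orders shows that the Euler
characteristic is invariant under definable bijections (`euler_eq_of_defBij`). It is additive and
sends `[M]ⁿ` to `Xⁿ`, so it is a left inverse of `polyHom`.

Surjectivity is a cell decomposition, by induction on the number of variables (`kcls_mem`): outside
the graphs of finitely many constants and translations, a definable set in `n + 1` variables agrees
with a cylinder `B × M`, and the part of a definable set inside these graphs is cut into pieces with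
injective projection to the first `n` variables.
-/

namespace ModelK0

open Set FirstOrder Filter

/-! ### Sets and functions determined by finitely many local data -/

section Local

variable {α β : Type} {S S' S'' : Type*} {N K K' : ℕ}

/-- The integers `a` and `b` differ by a multiple of `N` of absolute value at most `K`. -/
def Near (N K : ℕ) (a b : ℤ) : Prop := (N : ℤ) ∣ b - a ∧ |b - a| ≤ K

theorem Near.symm {a b : ℤ} (h : Near N K a b) : Near N K b a :=
  ⟨by rw [← neg_sub, dvd_neg]; exact h.1, by rw [abs_sub_comm]; exact h.2⟩

theorem Near.mono (hK : K ≤ K') {a b : ℤ} (h : Near N K a b) : Near N K' a b :=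
  ⟨h.1, h.2.trans (by exact_mod_cast hK)⟩

theorem Near.trans {a b c : ℤ} (h : Near N K a b) (h' : Near N K' b c) :
    Near N (K + K') a c := by
  refine ⟨by simpa using dvd_add h'.1 h.1, ?_⟩
  have h1 := h.2
  have h2 := h'.2
  rw [abs_le] at *
  push_cast
  constructor <;> linarith

theorem Near.congr {a b c d : ℤ} (h : Near N K a b) (e : b - a = d - c) : Near N K c d := by
  rwa [Near, ← e]

theorem Near.lt_add {a b : ℕ} (h : Near N K a b) : b < a + K + 1 := by
  have := (abs_le.mp h.2).2
  omega

theorem Near.exists_eq_add (hN : 0 < N) {a b : ℕ} (h : Near N K a b) (hle : a ≤ b) :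
    ∃ k, k ≤ K ∧ b = a + N * k := by
  obtain ⟨k, hk⟩ := Int.natCast_dvd_natCast.mp
    (by rw [Nat.cast_sub hle]; exact h.1 : (N : ℤ) ∣ ((b - a : ℕ) : ℤ))
  have := h.lt_add
  have := Nat.le_mul_of_pos_left k hN
  exact ⟨k, by omega, by omega⟩

/-- Two tuples of natural numbers look alike up to distance `K`: they have the same entries below
`K`, and the same differences that are multiples of `N` of absolute value at most `K`. -/
structure LocEq (N K : ℕ) (x y : α → ℕ) : Prop where
  small : ∀ i, x i < K ∨ y i < K → x i = y i
  near : ∀ i j, Near N K (x i) (x j) ∨ Near N K (y i) (y j) → (x j : ℤ) - x i = y j - y i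

theorem LocEq.symm {x y : α → ℕ} (h : LocEq N K x y) : LocEq N K y x :=
  ⟨fun i hi => (h.small i hi.symm).symm, fun i j hij => (h.near i j hij.symm).symm⟩

theorem LocEq.mono (hK : K ≤ K') {x y : α → ℕ} (h : LocEq N K' x y) : LocEq N K x y :=
  ⟨fun i hi => h.small i (by omega), fun i j hij => h.near i j (hij.imp (.mono hK) (.mono hK))⟩

/-- A function of tuples whose value depends on the tuple only up to `LocEq N K`, for some `K`.
The codomain `S` is arbitrary, so that the notion covers sets (`S = Prop`) as well as ring-valued
functions. -/
def IsLocal (N : ℕ) (f : (α → ℕ) → S) : Prop :=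
  ∃ K : ℕ, ∀ x y, LocEq N K x y → f x = f y

theorem isLocal_const (c : S) : IsLocal N (fun _ : α → ℕ => c) := ⟨0, fun _ _ _ => rfl⟩

theorem IsLocal.map {f : (α → ℕ) → S} (hf : IsLocal N f) (g : S → S') :
    IsLocal N fun x => g (f x) := by
  obtain ⟨K, hK⟩ := hf
  exact ⟨K, fun x y h => congrArg g (hK x y h)⟩

theorem IsLocal.map₂ {f : (α → ℕ) → S} {f' : (α → ℕ) → S'} (hf : IsLocal N f)
    (hf' : IsLocal N f') (g : S → S' → S'') : IsLocal N fun x => g (f x) (f' x) := by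
  obtain ⟨K, hK⟩ := hf
  obtain ⟨K', hK'⟩ := hf'
  refine ⟨max K K', fun x y h => ?_⟩
  dsimp only
  rw [hK x y (h.mono (le_max_left _ _)), hK' x y (h.mono (le_max_right _ _))]

/-- Locality is preserved when coordinates are renamed, repeated or replaced by constants. -/
theorem IsLocal.coordMap [Finite β] {f : (β → ℕ) → S} (hf : IsLocal N f) (t : β → α ⊕ ℕ) :
    IsLocal N fun x => f (coordMap t x) := by
  obtain ⟨K, hK⟩ := hf
  obtain ⟨C, hC⟩ : ∃ C : ℕ, ∀ i, Sum.elim (fun _ => 0) id (t i) ≤ C := by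
    obtain ⟨C, hC⟩ := (finite_range fun i => Sum.elim (fun _ : α => 0) id (t i)).bddAbove
    exact ⟨C, fun i => hC (mem_range_self i)⟩
  refine ⟨K + C + 1, fun x y h => hK _ _ ⟨fun i hi => ?_, fun i j hij => ?_⟩⟩
  · unfold ModelK0.coordMap at *
    revert hi
    rcases t i with a | c
    · exact fun hi => h.small a (by simp only [Sum.elim_inl] at hi; omega)
    · exact fun _ => rfl
  · have hi := hC i
    have hj := hC j
    unfold ModelK0.coordMap at *
    revert hi hj hij
    rcases t i with a | c <;> rcases t j with b | d <;> simp only [Sum.elim_inl, Sum.elim_inr, id]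
    · exact fun hij _ _ => h.near a b (hij.imp (.mono (by omega)) (.mono (by omega)))
    · intro hij _ _
      rw [h.small a (hij.imp (fun e => by have := e.symm.lt_add; omega)
        (fun e => by have := e.symm.lt_add; omega))]
    · intro hij _ _
      rw [h.small b (hij.imp (fun e => by have := e.lt_add; omega)
        (fun e => by have := e.lt_add; omega))]
    · simp

/-- The tuple `x` with one further entry `t`. -/
abbrev extend (x : α → ℕ) (t : ℕ) : Option α → ℕ := fun o => o.elim t x

/-- A finite partial injection of an infinite set extends to a permutation. -/
theorem exists_perm_of_rel {X : Type*} [Countable X] [Infinite X] (r : X → X → Prop)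
    (hf : ∀ {a b b'}, r a b → r a b' → b = b') (hi : ∀ {a a' b}, r a b → r a' b → a = a')
    (hfin : {a | ∃ b, r a b}.Finite) :
    ∃ φ : Equiv.Perm X, ∀ a, r a (φ a) ∨ (∀ b, ¬ r a b) ∧ ∀ a', ¬ r a' (φ a) := by
  classical
  set D : Set X := {a | ∃ b, r a b}
  set E : Set X := {b | ∃ a, r a b}
  have hE : E.Finite := by
    refine (hfin.image fun a => if h : ∃ b, r a b then h.choose else a).subset ?_
    rintro b ⟨a, hab⟩
    have h : ∃ b, r a b := ⟨b, hab⟩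
    exact ⟨a, h, by dsimp only; rw [dif_pos h]; exact hf h.choose_spec hab⟩
  let e : D ≃ E := Equiv.ofBijective (fun a => ⟨a.2.choose, a.1, a.2.choose_spec⟩)
    ⟨fun a b h => Subtype.ext (hi a.2.choose_spec
        (by rw [Subtype.mk.injEq] at h; rw [h]; exact b.2.choose_spec)),
      fun ⟨b, a, hab⟩ => ⟨⟨a, b, hab⟩, Subtype.ext (hf
        (Exists.choose_spec (⟨b, hab⟩ : ∃ b, r a b)) hab)⟩⟩
  have : Infinite ↑Dᶜ := hfin.infinite_compl.to_subtype
  have : Infinite ↑Eᶜ := hE.infinite_compl.to_subtype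
  obtain ⟨e'⟩ : Nonempty (↑Dᶜ ≃ ↑Eᶜ) := by
    obtain ⟨_⟩ := nonempty_denumerable ↑Dᶜ
    obtain ⟨_⟩ := nonempty_denumerable ↑Eᶜ
    exact ⟨Denumerable.equiv₂ _ _⟩
  refine ⟨(Equiv.Set.sumCompl D).symm.trans ((e.sumCongr e').trans (Equiv.Set.sumCompl E)),
    fun a => ?_⟩
  by_cases ha : a ∈ D
  · left
    simp only [Equiv.trans_apply, Equiv.Set.sumCompl_symm_apply_of_mem ha, Equiv.sumCongr_apply,
      Sum.map_inl, Equiv.Set.sumCompl_apply_inl]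
    exact Exists.choose_spec ha
  · right
    simp only [Equiv.trans_apply, Equiv.Set.sumCompl_symm_apply_of_notMem ha,
      Equiv.sumCongr_apply, Sum.map_inr, Equiv.Set.sumCompl_apply_inr]
    exact ⟨fun b hb => ha ⟨b, hb⟩, fun a' h => (e' ⟨a, ha⟩).2 ⟨a', h⟩⟩

/-- The back-and-forth step. A further entry `t` of `x` that is small or near an entry of `x` has
one possible partner over `y`, and there are finitely many such `t`; the others are
interchangeable. -/
theorem LocEq.exists_perm [Finite α] {x y : α → ℕ} (h : LocEq N (2 * K) x y) :
    ∃ φ : Equiv.Perm ℕ, ∀ t, LocEq N K (extend x t) (extend y (φ t)) := by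
  let r : ℕ → ℕ → Prop := fun t u =>
    (t < K ∧ u = t) ∨ ∃ i, Near N K (x i) t ∧ (t : ℤ) - x i = u - y i
  have hr : ∀ {t u}, r t u → (t < K ∨ u < K → t = u) ∧
      ∀ i, Near N K (x i) t ∨ Near N K (y i) u → (t : ℤ) - x i = u - y i := by
    rintro t u (⟨ht, rfl⟩ | ⟨i, hi, e⟩)
    · refine ⟨fun _ => rfl, fun i hi => ?_⟩
      rw [h.small i (hi.imp (fun e => by have := e.symm.lt_add; omega)
        (fun e => by have := e.symm.lt_add; omega))]
    · have hi' : Near N K (y i) u := hi.congr e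
      refine ⟨fun htu => ?_, fun j hj => ?_⟩
      · have := h.small i (htu.imp (fun _ => by have := hi.symm.lt_add; omega)
          (fun _ => by have := hi'.symm.lt_add; omega))
        omega
      · have := h.near i j (hj.imp (fun hj => by rw [two_mul]; exact hi.trans hj.symm)
          (fun hj => by rw [two_mul]; exact hi'.trans hj.symm))
        linarith
  obtain ⟨φ, hφ⟩ := exists_perm_of_rel r
    (fun {t u u'} h1 h2 => by
      rcases h2 with ⟨ht, rfl⟩ | ⟨i, hi, e⟩
      · exact ((hr h1).1 (.inl ht)).symm
      · have := (hr h1).2 i (.inl hi)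
        omega)
    (fun {t t' u} h1 h2 => by
      rcases h2 with ⟨ht, rfl⟩ | ⟨i, hi, e⟩
      · exact (hr h1).1 (.inr ht)
      · have := (hr h1).2 i (.inr (hi.congr e))
        omega)
    (by
      have hfin : (Iio K ∪ ⋃ i, Iio (x i + K + 1)).Finite :=
        (finite_Iio K).union (finite_iUnion fun i => finite_Iio _)
      refine hfin.subset ?_
      rintro t ⟨u, ⟨ht, -⟩ | ⟨i, hi, -⟩⟩
      · exact .inl ht
      · exact .inr (mem_iUnion.mpr ⟨i, hi.lt_add⟩))
  refine ⟨φ, fun t => ?_⟩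
  have key : (t < K ∨ φ t < K → t = φ t) ∧
      ∀ i, Near N K (x i) t ∨ Near N K (y i) (φ t) → (t : ℤ) - x i = φ t - y i := by
    rcases hφ t with ht | ⟨h1, h2⟩
    · exact hr ht
    · refine ⟨fun ht => ht.elim (fun ht => ?_) (fun ht => ?_),
        fun i ht => ht.elim (fun ht => ?_) (fun ht => ?_)⟩
      · exact (h1 t (.inl ⟨ht, rfl⟩)).elim
      · exact (h2 _ (.inl ⟨ht, rfl⟩)).elim
      · -- The partner `y i + (t - x i)` of `t` is a natural number: if `x i` is small, then it
        -- is `t`, and otherwise `y i` is at least `2 * K`.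
        have hlt := (abs_le.mp ht.2).1
        have hu : 0 ≤ (t : ℤ) - x i + y i := by
          by_cases hx : x i < 2 * K ∨ y i < 2 * K
          · have := h.small i hx
            omega
          · omega
        refine (h1 ((t : ℤ) - x i + y i).toNat (.inr ⟨i, ht, ?_⟩)).elim
        rw [Int.toNat_of_nonneg hu]
        ring
      · have hlt := (abs_le.mp ht.2).1
        have hu : 0 ≤ (φ t : ℤ) - y i + x i := by
          by_cases hx : x i < 2 * K ∨ y i < 2 * K
          · have := h.small i hx
            omega
          · omega
        refine (h2 ((φ t : ℤ) - y i + x i).toNat (.inr ⟨i, ?_, ?_⟩)).elim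
        · refine ht.congr ?_
          rw [Int.toNat_of_nonneg hu]
          ring
        · rw [Int.toNat_of_nonneg hu]
          ring
  refine ⟨?_, ?_⟩
  · rintro (_ | i) hi
    · exact key.1 hi
    · exact h.small i (by simp only [extend, Option.elim] at hi; omega)
  · rintro (_ | i) (_ | j) hij
    · simp [extend]
    · have := key.2 j (hij.imp .symm .symm)
      simp only [extend, Option.elim]
      linarith
    · exact key.2 i hij
    · exact h.near i j (hij.imp (.mono (by omega)) (.mono (by omega)))

/-- A quantifier that is invariant under permutations, applied to the last variable of a local
function, gives a local function. -/
theorem IsLocal.quantify [Finite α] {f : (Option α → ℕ) → S} (hf : IsLocal N f)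
    (Q : (ℕ → S) → S') (hQ : ∀ (φ : Equiv.Perm ℕ) h, Q (h ∘ φ) = Q h) :
    IsLocal N fun x => Q fun t => f (extend x t) := by
  obtain ⟨K, hK⟩ := hf
  refine ⟨2 * K, fun x y h => ?_⟩
  obtain ⟨φ, hφ⟩ := h.exists_perm
  dsimp only
  rw [← hQ φ fun t => f (extend y t)]
  exact congrArg Q (funext fun t => hK _ _ (hφ t))

/-- A local function is eventually constant in each variable. -/
theorem IsLocal.eventually_const [Finite α] {f : (Option α → ℕ) → S} (hf : IsLocal N f)
    (x : α → ℕ) : ∃ c, ∀ᶠ t in cofinite, f (extend x t) = c := by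
  obtain ⟨K, hK⟩ := hf
  obtain ⟨B, hB⟩ := (finite_range x).bddAbove
  refine ⟨f (extend x (B + K + 1)), ?_⟩
  rw [Nat.cofinite_eq_atTop]
  filter_upwards [eventually_ge_atTop (B + K + 1)] with t ht
  have far : ∀ u, B + K + 1 ≤ u → ∀ i, ¬ Near N K (x i) u := fun u hu i hi => by
    have := hi.lt_add
    have := hB (mem_range_self i)
    omega
  refine hK _ _ ⟨?_, ?_⟩
  · rintro (_ | i) hi
    · simp only [extend, Option.elim] at hi
      omega
    · rfl
  · rintro (_ | i) (_ | j) hij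
    · simp [extend]
    · exact (hij.elim (fun h => far _ ht _ h.symm) (fun h => far _ le_rfl _ h.symm)).elim
    · exact (hij.elim (far _ ht _) (far _ le_rfl _)).elim
    · rfl

end Local

/-! ### The structure of natural numbers with translation by a fixed number -/

section Structure

/-- The relation symbols of the language of a translation: one binary symbol. -/
inductive ShiftRel : ℕ → Type
  | shift : ShiftRel 2

/-- The language with one binary relation symbol. The parameter `N` is only used to select the
structure on `ℕ`. -/
def shiftLang (_N : ℕ) : FirstOrder.Language.{0, 0} := ⟨fun _ => Empty, ShiftRel⟩

/-- The structure `(ℕ, x ↦ x + N)`, where the symbol denotes the graph of the translation. -/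
instance (N : ℕ) : (shiftLang N).Structure ℕ where
  funMap := fun f => f.elim
  RelMap := fun r => match r with
    | .shift => fun v => v 1 = v 0 + N

variable {α : Type} {N : ℕ}

theorem isLocal_realize [Finite α] {n : ℕ} (φ : (shiftLang N).BoundedFormula α n) :
    IsLocal N fun w : α ⊕ Fin n → ℕ => φ.Realize (w ∘ Sum.inl) (w ∘ Sum.inr) := by
  have hterm : ∀ {n : ℕ} (t : (shiftLang N).Term (α ⊕ Fin n)), ∃ i, ∀ w : α ⊕ Fin n → ℕ,
      t.realize (Sum.elim (w ∘ Sum.inl) (w ∘ Sum.inr)) = w i := by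
    rintro n (i | ⟨f, -⟩)
    · exact ⟨i, fun w => by rcases i with i | i <;> rfl⟩
    · exact f.elim
  induction φ with
  | falsum => exact isLocal_const _
  | equal t₁ t₂ =>
    obtain ⟨i, hi⟩ := hterm t₁
    obtain ⟨j, hj⟩ := hterm t₂
    refine ⟨0, fun x y h => ?_⟩
    simp only [FirstOrder.Language.BoundedFormula.Realize, hi, hj]
    have h0 : ∀ z : _ → ℕ, z i = z j → Near N 0 (z i) (z j) := fun z e => by simp [Near, e]
    have := h.near i j
    exact propext ⟨fun e => by have := this (.inl (h0 x e)); omega,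
      fun e => by have := this (.inr (h0 y e)); omega⟩
  | rel R ts =>
    cases R
    obtain ⟨i, hi⟩ := hterm (ts 0)
    obtain ⟨j, hj⟩ := hterm (ts 1)
    refine ⟨N, fun x y h => ?_⟩
    simp only [FirstOrder.Language.BoundedFormula.Realize, FirstOrder.Language.Structure.RelMap,
      hi, hj]
    have h0 : ∀ z : _ → ℕ, z j = z i + N → Near N N (z i) (z j) := fun z e => by simp [Near, e]
    have := h.near i j
    exact propext ⟨fun e => by have := this (.inl (h0 x e)); omega,
      fun e => by have := this (.inr (h0 y e)); omega⟩
  | imp f₁ f₂ ih₁ ih₂ => exact ih₁.map₂ ih₂ fun p q => p → q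
  | @all n f ih =>
    let t : α ⊕ Fin (n + 1) → Option (α ⊕ Fin n) :=
      Sum.elim (fun i => some (.inl i)) (Fin.lastCases none fun j => some (.inr j))
    have h := (ih.coordMap fun i => .inl (t i)).quantify (fun p => ∀ t, p t)
      (fun φ p => propext φ.surjective.forall.symm)
    refine (congrArg (IsLocal N) (funext fun w => ?_)).mp h
    refine propext (forall_congr' fun a => iff_of_eq ?_)
    congr 1
    funext j
    refine Fin.lastCases ?_ (fun j => ?_) j
    · simp [coordMap, t]
    · simp [coordMap, t]

/-- Quantifier elimination in semantic form: definable sets are local. The finitely many parameters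
of a formula are treated as coordinates that are then replaced by constants. -/
theorem isLocal_mem [Finite α] {A : Set (α → ℕ)} (hA : Def (shiftLang N) A) :
    IsLocal N (· ∈ A) := by
  obtain ⟨A₀, -, hA⟩ := definable_iff_finitely_definable.mp hA
  obtain ⟨φ, rfl⟩ := definable_iff_exists_formula_sum.mp hA
  have h := isLocal_realize (N := N) φ
  let t : (A₀ : Set ℕ) ⊕ α ⊕ Fin 0 → (α ⊕ ℕ) :=
    Sum.elim (fun c => .inr c) (Sum.elim .inl Fin.elim0)
  have h' := h.coordMap (α := α) fun i => t (Equiv.sumAssoc _ _ _ i)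
  refine (congrArg (IsLocal N) (funext fun w => ?_)).mp h'
  simp only [mem_ofPred_eq, FirstOrder.Language.Formula.Realize]
  congr 1
  · funext i
    rcases i with i | i <;> rfl
  · funext i
    exact i.elim0

end Structure

/-! ### Integration of eventually constant functions -/

section Integral

set_option linter.unusedSectionVars false

variable {R : Type*} [CommRing R] {X : R} {h g : ℕ → R} {c d : R}

/-- The function `h` takes the value `c` outside a finite set. -/
def HasTail (h : ℕ → R) (c : R) : Prop := ∀ᶠ t in cofinite, h t = c

/-- The value of an eventually constant function outside a finite set (and a junk value for other
functions). -/
noncomputable def tail (h : ℕ → R) : R := Classical.epsilon (HasTail h)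

/-- The integral of an eventually constant function on `ℕ` for the finitely additive measure that
gives a point the measure `1` and the whole of `ℕ` the measure `X`. -/
noncomputable def integ (X : R) (h : ℕ → R) : R := tail h * X + ∑ᶠ t, (h t - tail h)

theorem HasTail.const (c : R) : HasTail (fun _ => c) c := Eventually.of_forall fun _ => rfl

theorem HasTail.of_ge {K : ℕ} (hK : ∀ t, K ≤ t → h t = c) : HasTail h c := by
  rw [HasTail, Nat.cofinite_eq_atTop]
  filter_upwards [eventually_ge_atTop K] with t ht using hK t ht

theorem HasTail.add (hc : HasTail h c) (hd : HasTail g d) :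
    HasTail (fun t => h t + g t) (c + d) := by
  filter_upwards [hc, hd] with t h1 h2 using by rw [h1, h2]

theorem HasTail.mul (hc : HasTail h c) (hd : HasTail g d) :
    HasTail (fun t => h t * g t) (c * d) := by
  filter_upwards [hc, hd] with t h1 h2 using by rw [h1, h2]

theorem HasTail.single (a : ℕ) (r : R) : HasTail (fun t => if t = a then r else 0) 0 :=
  .of_ge (K := a + 1) fun t ht => if_neg (by omega)

theorem HasTail.tail_eq (hc : HasTail h c) : tail h = c := by
  have h1 : HasTail h (tail h) := Classical.epsilon_spec (p := HasTail h) ⟨c, hc⟩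
  obtain ⟨t, e1, e2⟩ := (h1.and hc).exists
  rw [← e1, e2]

theorem HasTail.finite_support (hc : HasTail h c) :
    (Function.support fun t => h t - c).Finite := by
  refine Set.Finite.subset hc fun t ht he => ?_
  simp only [mem_ofPred_eq] at he
  simp [he] at ht

theorem HasTail.integ_eq (hc : HasTail h c) : integ X h = c * X + ∑ᶠ t, (h t - c) := by
  rw [integ, hc.tail_eq]

theorem integ_comp_perm (φ : Equiv.Perm ℕ) (h : ℕ → R) : integ X (h ∘ φ) = integ X h := by
  have hT : HasTail (h ∘ φ) = HasTail h := by
    funext c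
    refine propext ⟨fun H => ?_, fun H => φ.injective.tendsto_cofinite.eventually H⟩
    refine (φ.symm.injective.tendsto_cofinite.eventually H).mono fun t ht => ?_
    simpa using ht
  rw [integ, integ, tail, tail, hT]
  congr 1
  exact finsum_comp_equiv φ (f := fun t => h t - Classical.epsilon (HasTail h))

theorem integ_const (c : R) : integ X (fun _ => c) = c * X := by
  simp [(HasTail.const c).integ_eq]

theorem integ_single (a : ℕ) (r : R) : integ X (fun t => if t = a then r else 0) = r := by
  rw [(HasTail.single a r).integ_eq, finsum_eq_single _ a fun t ht => by simp [ht] ]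
  simp

theorem integ_add (hc : HasTail h c) (hd : HasTail g d) :
    integ X (fun t => h t + g t) = integ X h + integ X g := by
  rw [(hc.add hd).integ_eq, hc.integ_eq, hd.integ_eq,
    finsum_congr fun t => show h t + g t - (c + d) = (h t - c) + (g t - d) by ring,
    finsum_add_distrib hc.finite_support hd.finite_support]
  ring

theorem integ_const_mul (a : R) (hc : HasTail h c) :
    integ X (fun t => a * h t) = a * integ X h := by
  rw [((HasTail.const a).mul hc).integ_eq, hc.integ_eq,
    finsum_congr fun t => show a * h t - a * c = a * (h t - c) by ring,
    ← mul_finsum' _ _ hc.finite_support]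
  ring

theorem integ_mul_const (a : R) (hc : HasTail h c) :
    integ X (fun t => h t * a) = integ X h * a := by
  rw [mul_comm, ← integ_const_mul a hc]
  exact congrArg _ (funext fun t => mul_comm _ _)

theorem integ_ite_ge (K : ℕ) (r : R) :
    integ X (fun t => if K ≤ t then r else 0) = r * X - K * r := by
  have hT : HasTail (fun t => if K ≤ t then r else 0) r := .of_ge (K := K) fun t ht => if_pos ht
  rw [hT.integ_eq, finsum_eq_sum_of_support_subset (s := Finset.range K)]
  · rw [Finset.sum_congr rfl fun t ht => show (if K ≤ t then r else 0) - r = -r by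
      rw [if_neg (by simpa using ht), zero_sub] ]
    simp [sub_eq_add_neg]
  · intro t ht
    by_contra h
    simp only [Finset.coe_range, mem_Iio, not_lt] at h
    simp [h] at ht

/-! ### Interchange of two integrals -/

/-- Both iterated integrals of `f` are iterated integrals of eventually constant functions, and they
are equal. -/
structure Fubini (X : R) (f : ℕ → ℕ → R) : Prop where
  row : ∀ s, ∃ c, HasTail (f s) c
  col : ∀ t, ∃ c, HasTail (fun s => f s t) c
  integ_row : ∃ c, HasTail (fun s => integ X (f s)) c
  integ_col : ∃ c, HasTail (fun t => integ X fun s => f s t) c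
  eq : integ X (fun s => integ X (f s)) = integ X fun t => integ X fun s => f s t

theorem Fubini.flip {f : ℕ → ℕ → R} (hf : Fubini X f) : Fubini X fun s t => f t s :=
  ⟨hf.col, hf.row, hf.integ_col, hf.integ_row, hf.eq.symm⟩

theorem Fubini.add {f f' : ℕ → ℕ → R} (hf : Fubini X f) (hf' : Fubini X f') :
    Fubini X fun s t => f s t + f' s t := by
  choose r hr using hf.row
  choose r' hr' using hf'.row
  choose q hq using hf.col
  choose q' hq' using hf'.col
  obtain ⟨u, hu⟩ := hf.integ_row
  obtain ⟨u', hu'⟩ := hf'.integ_row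
  obtain ⟨v, hv⟩ := hf.integ_col
  obtain ⟨v', hv'⟩ := hf'.integ_col
  have e1 := fun s => integ_add (X := X) (hr s) (hr' s)
  have e2 := fun t => integ_add (X := X) (hq t) (hq' t)
  refine ⟨fun s => ⟨_, (hr s).add (hr' s)⟩, fun t => ⟨_, (hq t).add (hq' t)⟩, ?_, ?_, ?_⟩
  · simp only [e1]
    exact ⟨_, hu.add hu'⟩
  · simp only [e2]
    exact ⟨_, hv.add hv'⟩
  · simp only [e1, e2]
    rw [integ_add hu hu', integ_add hv hv', hf.eq, hf'.eq]

theorem Fubini.prod (hc : HasTail h c) (hd : HasTail g d) : Fubini X fun s t => h s * g t := by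
  have e1 := fun s => integ_const_mul (X := X) (h s) hd
  have e2 := fun t => integ_mul_const (X := X) (g t) hc
  refine ⟨fun s => ⟨_, (HasTail.const _).mul hd⟩, fun t => ⟨_, hc.mul (.const _)⟩, ?_, ?_, ?_⟩
  · simp only [e1]
    exact ⟨_, hc.mul (.const _)⟩
  · simp only [e2]
    exact ⟨_, (HasTail.const _).mul hd⟩
  · simp only [e1, e2]
    rw [integ_mul_const _ hc, integ_const_mul _ hd]

theorem Fubini.zero : Fubini X fun _ _ => 0 := by
  simpa using Fubini.prod (X := X) (HasTail.const 0) (HasTail.const 0)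

theorem Fubini.sum {ι : Type*} (s : Finset ι) {F : ι → ℕ → ℕ → R} (hF : ∀ i ∈ s, Fubini X (F i)) :
    Fubini X fun m n => ∑ i ∈ s, F i m n := by
  classical
  induction s using Finset.induction_on with
  | empty => simpa using Fubini.zero
  | insert i s hi ih =>
    simp only [Finset.sum_insert hi]
    exact (hF i (by simp)).add (ih fun j hj => hF j (by simp [hj]))

/-- For the graph of the translation by a multiple of `N`, one order of integration gives the
integral of `1` over `ℕ` and the other the integral of `1` over the image of the translation. These
are equal because `N` vanishes in `R`. -/
theorem Fubini.diag {N : ℕ} (hN : (N : R) = 0) (k : ℕ) (r : R) :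
    Fubini X fun s t => if t = s + N * k then r else 0 := by
  have e1 := fun s => integ_single (X := X) (s + N * k) r
  have e2 : ∀ t, (fun s => if t = s + N * k then r else 0) =
      fun s => if s = t - N * k then (if N * k ≤ t then r else 0) else 0 := by
    intro t
    funext s
    by_cases h1 : N * k ≤ t
    · simp only [h1, if_true]
      exact if_congr (by omega) rfl rfl
    · rw [if_neg h1, ite_self, if_neg (by omega)]
  refine ⟨fun s => ⟨_, .single _ _⟩, fun t => ⟨0, by rw [e2]; exact .single _ _⟩, ?_, ?_, ?_⟩
  · simp only [e1]
    exact ⟨_, .const _⟩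
  · simp only [e2, integ_single]
    exact ⟨r, .of_ge (K := N * k) fun t ht => if_pos ht⟩
  · simp only [e1, e2, integ_single]
    rw [integ_const, integ_ite_ge]
    simp [hN]

/-- A function that is constant on a quadrant and eventually constant in each variable is a finite
sum of products of functions of one variable. -/
theorem Fubini.of_quadrant {f : ℕ → ℕ → R} {K : ℕ} (hr : ∀ s, ∃ c, HasTail (f s) c)
    (hc : ∀ t, ∃ c, HasTail (fun s => f s t) c) (hK : ∀ s t, K ≤ s → K ≤ t → f s t = c) :
    Fubini X f := by
  choose r hr using hr
  choose q hq using hc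
  have hge : ∀ x : R, HasTail (fun t => if K ≤ t then x else 0) x := fun x =>
    .of_ge (K := K) fun t ht => if_pos ht
  have h1 := Fubini.sum (X := X) (Finset.range K) fun a _ =>
    Fubini.prod (HasTail.single a 1) (hr a)
  have h2 := Fubini.sum (X := X) (Finset.range K) fun b _ =>
    Fubini.prod ((hge 1).mul (hq b)) (HasTail.single b 1)
  have h3 := Fubini.prod (X := X) (hge 1) (hge c)
  refine (congrArg (Fubini X) (funext₂ fun s t => ?_)).mp ((h1.add h2).add h3)
  by_cases hs : s < K
  · simp [hs, not_le.mpr hs, Finset.sum_ite_eq]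
  · by_cases ht : t < K
    · simp [hs, not_lt.mp hs, ht, not_le.mpr ht]
    · simp [hs, not_lt.mp hs, ht, not_lt.mp ht, hK s t (not_lt.mp hs) (not_lt.mp ht)]

/-- A local function of two variables is the sum of a function that is constant on a quadrant and of
finitely many multiples of indicator functions of graphs of translations by multiples of `N`. -/
theorem IsLocal.fubini {N : ℕ} (hN : (N : R) = 0) (hN' : 0 < N) {f : ℕ → ℕ → R}
    (hf : IsLocal N fun v : Fin 2 → ℕ => f (v 0) (v 1)) : Fubini X f := by
  have hr : ∀ s, ∃ c, HasTail (f s) c := fun s =>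
    (hf.coordMap (α := Option Empty) ![.inr s, .inl none]).eventually_const Empty.elim
  have hc : ∀ t, ∃ c, HasTail (fun s => f s t) c := fun t =>
    (hf.coordMap (α := Option Empty) ![.inl none, .inr t]).eventually_const Empty.elim
  obtain ⟨K, hK⟩ := hf
  have hK' : ∀ s t s' t', K ≤ s → K ≤ t → K ≤ s' → K ≤ t' →
      (Near N K s t ∨ Near N K s' t' → (t : ℤ) - s = t' - s') → f s t = f s' t' := by
    intro s t s' t' h1 h2 h3 h4 h5
    refine hK ![s, t] ![s', t'] ⟨fun i hi => ?_, fun i j hij => ?_⟩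
    · fin_cases i <;> simp at hi <;> omega
    · fin_cases i <;> fin_cases j
      · simp
      · exact h5 hij
      · have := h5 (hij.imp .symm .symm)
        simp
        linarith
      · simp
  -- The value at generic pairs, and the values on the diagonals.
  set c := f K (2 * K + 1)
  have h1 := Fubini.sum (X := X) (Finset.range (K + 1)) fun k _ =>
    Fubini.diag hN k (f K (K + N * k) - c)
  have h2 := Fubini.sum (X := X) (Finset.range K) fun k _ =>
    (Fubini.diag hN (k + 1) (f (K + N * (k + 1)) K - c)).flip
  have h12 := h1.add h2
  have hneg : ∀ {h : ℕ → R} {d : R}, HasTail h d → HasTail (fun t => -h t) (-d) := fun hd =>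
    Eventually.mono hd fun t ht => congrArg Neg.neg ht
  have h3 : Fubini X fun s t => f s t +
      -((∑ k ∈ Finset.range (K + 1), if t = s + N * k then f K (K + N * k) - c else 0) +
      ∑ k ∈ Finset.range K, if s = t + N * (k + 1) then f (K + N * (k + 1)) K - c else 0) := by
    refine .of_quadrant (c := c) (K := K) (fun s => ?_) (fun t => ?_) fun s t hs ht => ?_
    · obtain ⟨a, ha⟩ := hr s
      obtain ⟨b, hb⟩ := h12.row s
      exact ⟨_, ha.add (hneg hb)⟩
    · obtain ⟨a, ha⟩ := hc t
      obtain ⟨b, hb⟩ := h12.col t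
      exact ⟨_, ha.add (hneg hb)⟩
    · have hinj : ∀ {k l}, N * k = N * l → k = l := fun e => Nat.eq_of_mul_eq_mul_left hN' e
      by_cases hd : ∃ k, k ≤ K ∧ t = s + N * k
      · obtain ⟨k, hk, e⟩ := hd
        rw [Finset.sum_eq_single k, Finset.sum_eq_zero, if_pos e,
          hK' s t K (K + N * k) hs ht le_rfl (by omega) fun _ => by push_cast [e]; ring]
        · ring
        · intro l _
          rw [if_neg]
          rw [mul_add, mul_one]
          omega
        · intro l _ hl
          rw [if_neg]
          exact fun e' => hl (hinj (by omega))
        · intro h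
          simp at h
          omega
      · by_cases hd' : ∃ k, k < K ∧ s = t + N * (k + 1)
        · obtain ⟨k, hk, e⟩ := hd'
          rw [Finset.sum_eq_zero, Finset.sum_eq_single k, if_pos e,
            hK' s t (K + N * (k + 1)) K hs ht (by omega) le_rfl fun _ => by push_cast [e]; ring]
          · ring
          · intro l _ hl
            rw [if_neg]
            exact fun e' => hl (by have := hinj (k := l + 1) (l := k + 1) (by omega); omega)
          · intro h
            simp at h
            omega
          · intro l _
            rw [if_neg]
            rw [mul_add, mul_one] at e
            omega
        · push Not at hd hd'
          rw [Finset.sum_eq_zero, Finset.sum_eq_zero, hK' s t K (2 * K + 1) hs ht le_rfl (by omega)]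
          · ring
          · rintro (hst | hst)
            · rcases le_total s t with hle | hle
              · obtain ⟨k, hk, e⟩ := hst.exists_eq_add hN' hle
                exact (hd k hk e).elim
              · obtain ⟨k, hk, e⟩ := hst.symm.exists_eq_add hN' hle
                rcases k with _ | k
                · exact (hd 0 (by omega) (by simp at e ⊢; omega)).elim
                · exact (hd' k (by omega) e).elim
            · have := hst.lt_add
              omega
          · intro l hl
            exact if_neg (hd' l (by simpa using hl))
          · intro l hl
            exact if_neg (hd l (by simpa [Nat.lt_succ_iff] using hl))
  refine (congrArg (Fubini X) (funext₂ fun s t => ?_)).mp (h3.add h12)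
  ring

end Integral

/-! ### Iterated integrals and the Euler characteristic -/

section Iterated

set_option linter.unusedSectionVars false

variable {R : Type*} [CommRing R] {X : R} {N : ℕ} {α β : Type} {S : Type*}

/-- Locality is preserved by substitutions all of whose coordinates are coordinates or constants. -/
theorem IsLocal.comp [Finite β] {f : (β → ℕ) → S} (hf : IsLocal N f) (g : (α → ℕ) → β → ℕ)
    (hg : ∀ i, (∃ j, ∀ x, g x i = x j) ∨ ∃ c, ∀ x, g x i = c) : IsLocal N fun x => f (g x) := by
  have : ∀ i, ∃ t : α ⊕ ℕ, ∀ x, g x i = Sum.elim x id t := fun i => by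
    rcases hg i with ⟨j, hj⟩ | ⟨c, hc⟩
    · exact ⟨.inl j, hj⟩
    · exact ⟨.inr c, hc⟩
  choose t ht using this
  have e : g = ModelK0.coordMap t := funext₂ fun x i => ht i x
  rw [e]
  exact hf.coordMap t

/-- The `n`-fold iterated integral. -/
noncomputable def iint (X : R) : (n : ℕ) → ((Fin n → ℕ) → R) → R
  | 0, f => f Fin.elim0
  | n + 1, f => integ X fun t => iint X n fun v => f (Fin.cons t v)

theorem iint_zero (X : R) (f : (Fin 0 → ℕ) → R) : iint X 0 f = f Fin.elim0 := rfl

theorem iint_succ (X : R) (n : ℕ) (f : (Fin (n + 1) → ℕ) → R) :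
    iint X (n + 1) f = integ X fun t => iint X n fun v => f (Fin.cons t v) := rfl

theorem iint_const (n : ℕ) (c : R) : iint X n (fun _ => c) = c * X ^ n := by
  induction n with
  | zero => simp [iint_zero]
  | succ n ih => simp only [iint_succ, ih, integ_const, pow_succ, mul_assoc]

theorem iint_eq_zero (n : ℕ) : iint X n (fun _ => 0) = 0 := by
  rw [iint_const, zero_mul]

theorem isLocal_iint {n : ℕ} [Finite α] {f : (α ⊕ Fin n → ℕ) → R} (hf : IsLocal N f) :
    IsLocal N fun x => iint X n fun v => f (Sum.elim x v) := by
  induction n generalizing α with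
  | zero =>
    refine hf.comp (fun x => Sum.elim x Fin.elim0) ?_
    rintro (i | i)
    · exact .inl ⟨i, fun _ => rfl⟩
    · exact i.elim0
  | succ n ih =>
    have h := hf.comp (α := Option α ⊕ Fin n)
      (fun w => Sum.elim (fun i => w (.inl (some i)))
        (Fin.cons (α := fun _ => ℕ) (w (.inl none)) (fun j => w (.inr j)))) (by
      rintro (i | i)
      · exact .inl ⟨_, fun _ => rfl⟩
      · refine Fin.cases ?_ (fun i => ?_) i
        · exact .inl ⟨_, fun _ => rfl⟩
        · exact .inl ⟨_, fun _ => rfl⟩)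
    exact (ih h).quantify (integ X) integ_comp_perm

theorem IsLocal.cons {n : ℕ} {f : (Fin (n + 1) → ℕ) → S} (hf : IsLocal N f) (t : ℕ) :
    IsLocal N fun v => f (Fin.cons t v) := by
  refine hf.comp (fun v => Fin.cons (α := fun _ => ℕ) t v) fun i => ?_
  refine Fin.cases ?_ (fun i => ?_) i
  · exact .inr ⟨t, fun _ => rfl⟩
  · exact .inl ⟨i, fun _ => rfl⟩

theorem IsLocal.hasTail_iint {n : ℕ} {f : (Fin (n + 1) → ℕ) → R} (hf : IsLocal N f) :
    ∃ c, HasTail (fun t => iint X n fun v => f (Fin.cons t v)) c := by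
  have h := hf.comp (α := Option Empty ⊕ Fin n)
    (fun w => Fin.cons (α := fun _ => ℕ) (w (.inl none)) fun j => w (.inr j)) fun i => by
      refine Fin.cases ?_ (fun i => ?_) i
      · exact .inl ⟨_, fun _ => rfl⟩
      · exact .inl ⟨_, fun _ => rfl⟩
  exact (isLocal_iint (X := X) h).eventually_const Empty.elim

theorem iint_add {n : ℕ} {f g : (Fin n → ℕ) → R} (hf : IsLocal N f) (hg : IsLocal N g) :
    iint X n (fun v => f v + g v) = iint X n f + iint X n g := by
  induction n with
  | zero => rfl
  | succ n ih =>
    obtain ⟨c, hc⟩ := hf.hasTail_iint (X := X)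
    obtain ⟨d, hd⟩ := hg.hasTail_iint (X := X)
    simp only [iint_succ]
    rw [← integ_add hc hd]
    exact congrArg _ (funext fun t => ih (hf.cons t) (hg.cons t))

theorem integ_iint_comm (hN : (N : R) = 0) (hN' : 0 < N) {m : ℕ} {f : ℕ → (Fin m → ℕ) → R}
    (hf : IsLocal N fun w : Option (Fin m) → ℕ => f (w none) fun j => w (some j)) :
    integ X (fun t => iint X m (f t)) = iint X m fun y => integ X fun t => f t y := by
  induction m with
  | zero =>
    exact congrArg (integ X) (funext fun t => congrArg (f t) (Subsingleton.elim _ _))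
  | succ m ih =>
    have h1 : IsLocal N fun w : Fin 2 ⊕ Fin m → ℕ =>
        f (w (.inl 0)) (Fin.cons (w (.inl 1)) fun j => w (.inr j)) :=
      hf.comp (α := Fin 2 ⊕ Fin m) (fun w o => o.elim (w (.inl 0))
        (Fin.cons (α := fun _ => ℕ) (w (.inl 1)) fun j => w (.inr j))) (by
      rintro (_ | i)
      · exact .inl ⟨_, fun _ => rfl⟩
      · refine Fin.cases ?_ (fun i => ?_) i
        · exact .inl ⟨_, fun _ => rfl⟩
        · exact .inl ⟨_, fun _ => rfl⟩)
    have h2 := (isLocal_iint (X := X) h1).fubini (X := X) hN hN'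
      (f := fun s t => iint X m fun v => f s (Fin.cons t v))
    simp only [iint_succ]
    rw [h2.eq]
    refine congrArg _ (funext fun s => ih ?_)
    refine hf.comp (fun w o => o.elim (w none)
        (Fin.cons (α := fun _ => ℕ) s fun j => w (some j))) ?_
    rintro (_ | i)
    · exact .inl ⟨_, fun _ => rfl⟩
    · refine Fin.cases ?_ (fun i => ?_) i
      · exact .inr ⟨s, fun _ => rfl⟩
      · exact .inl ⟨_, fun _ => rfl⟩

/-- Two blocks of integrals of a local function may be interchanged. -/
theorem iint_comm (hN : (N : R) = 0) (hN' : 0 < N) {n m : ℕ}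
    {f : (Fin n → ℕ) → (Fin m → ℕ) → R}
    (hf : IsLocal N fun w : Fin n ⊕ Fin m → ℕ => f (w ∘ Sum.inl) (w ∘ Sum.inr)) :
    iint X n (fun x => iint X m (f x)) = iint X m fun y => iint X n fun x => f x y := by
  induction n with
  | zero => rfl
  | succ n ih =>
    simp only [iint_succ]
    have h1 : IsLocal N fun w : Option (Fin m) ⊕ Fin n → ℕ =>
        f (Fin.cons (w (.inl none)) fun j => w (.inr j)) fun i => w (.inl (some i)) := by
      refine hf.comp (α := Option (Fin m) ⊕ Fin n) (fun w => Sum.elim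
        (Fin.cons (α := fun _ => ℕ) (w (.inl none)) fun j => w (.inr j)) fun i => w (.inl (some i))) ?_
      rintro (i | i)
      · refine Fin.cases ?_ (fun i => ?_) i
        · exact .inl ⟨_, fun _ => rfl⟩
        · exact .inl ⟨_, fun _ => rfl⟩
      · exact .inl ⟨_, fun _ => rfl⟩
    have h2 := isLocal_iint (X := X) h1
    rw [← integ_iint_comm hN hN' (f := fun t y => iint X n fun x => f (Fin.cons t x) y) h2]
    refine congrArg _ (funext fun t => ih ?_)
    refine hf.comp (fun w => Sum.elim (Fin.cons (α := fun _ => ℕ) t (w ∘ Sum.inl))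
      (w ∘ Sum.inr)) ?_
    rintro (i | i)
    · refine Fin.cases ?_ (fun i => ?_) i
      · exact .inr ⟨t, fun _ => rfl⟩
      · exact .inl ⟨_, fun _ => rfl⟩
    · exact .inl ⟨_, fun _ => rfl⟩

open Classical in
/-- The Iverson bracket: `1` if `p` holds, and `0` otherwise. -/
noncomputable def iverson (p : Prop) : R := if p then 1 else 0

theorem iverson_pos {p : Prop} (h : p) : (iverson p : R) = 1 := if_pos h

theorem iverson_neg {p : Prop} (h : ¬ p) : (iverson p : R) = 0 := if_neg h

theorem iint_iverson_eq {n : ℕ} (a : Fin n → ℕ) : iint X n (fun v => iverson (v = a)) = 1 := by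
  induction n with
  | zero => exact iverson_pos (Subsingleton.elim _ _)
  | succ n ih =>
    rw [iint_succ, ← integ_single (X := X) (a 0) 1]
    refine congrArg _ (funext fun t => ?_)
    split_ifs with ht
    · rw [← ih (Fin.tail a)]
      refine congrArg _ (funext fun v => congrArg _ (propext ?_))
      rw [← Fin.cons_self_tail a, Fin.cons_inj]
      simp [ht]
    · rw [← iint_eq_zero (X := X) n]
      refine congrArg _ (funext fun v => iverson_neg fun e => ht ?_)
      rw [← e, Fin.cons_zero]

/-- The Euler characteristic of a set of tuples: the integral of its indicator function. -/
noncomputable def euler (X : R) {n : ℕ} (A : Set (Fin n → ℕ)) : R :=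
  iint X n fun v => iverson (v ∈ A)

theorem euler_empty (n : ℕ) : euler X (∅ : Set (Fin n → ℕ)) = 0 := by
  simp only [euler, mem_empty_iff_false, iverson_neg not_false, iint_eq_zero]

theorem euler_univ (n : ℕ) : euler X (univ : Set (Fin n → ℕ)) = X ^ n := by
  simp only [euler, mem_univ, iverson_pos trivial, iint_const, one_mul]

theorem euler_union {n : ℕ} {A B : Set (Fin n → ℕ)} (hA : Def (shiftLang N) A)
    (hB : Def (shiftLang N) B) (hd : Disjoint A B) : euler X (A ∪ B) = euler X A + euler X B := by
  rw [euler, euler, euler, ← iint_add ((isLocal_mem hA).map _) ((isLocal_mem hB).map _)]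
  refine congrArg _ (funext fun v => ?_)
  by_cases hv : v ∈ A
  · rw [iverson_pos hv, iverson_pos (mem_union_left B hv),
      iverson_neg (disjoint_left.mp hd hv), add_zero]
  · by_cases hv' : v ∈ B
    · rw [iverson_neg hv, iverson_pos (mem_union_right A hv'), iverson_pos hv', zero_add]
    · rw [iverson_neg hv, iverson_neg hv',
        iverson_neg (p := v ∈ A ∪ B) (not_or.mpr ⟨hv, hv'⟩), add_zero]

/-- The graph of a definable bijection has points as fibres over both sides, so that integration of
its indicator function in the two orders gives both Euler characteristics. -/
theorem euler_eq_of_defBij (hN : (N : R) = 0) (hN' : 0 < N) {n m : ℕ} {A : Set (Fin n → ℕ)}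
    {B : Set (Fin m → ℕ)} (h : DefBij (shiftLang N) A B) : euler X A = euler X B := by
  obtain ⟨f, hf, hd⟩ := h
  have hL := (isLocal_mem hd).map (fun p => (iverson p : R))
  have hc := iint_comm (X := X) hN hN' (f := fun x y => iverson (x ∈ A ∧ y = f x)) hL
  have h1 : ∀ x, iint X m (fun y => iverson (x ∈ A ∧ y = f x)) = iverson (x ∈ A) := by
    intro x
    by_cases hx : x ∈ A
    · simp only [hx, true_and, iint_iverson_eq, iverson_pos trivial]
    · simp only [hx, false_and, iverson_neg not_false, iint_eq_zero]
  have h2 : ∀ y, iint X n (fun x => iverson (x ∈ A ∧ y = f x)) = iverson (y ∈ B) := by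
    intro y
    by_cases hy : y ∈ B
    · obtain ⟨a, ha, rfl⟩ := hf.surjOn hy
      rw [iverson_pos hy, ← iint_iverson_eq (X := X) a]
      refine congrArg _ (funext fun x => congrArg _ (propext ⟨fun hx => ?_, ?_⟩))
      · exact hf.injOn hx.1 ha hx.2.symm
      · rintro rfl
        exact ⟨ha, rfl⟩
    · rw [iverson_neg hy, ← iint_eq_zero (X := X) n]
      exact congrArg _ (funext fun x => iverson_neg fun hx => hy (hx.2 ▸ hf.mapsTo hx.1))
  simp only [h1, h2] at hc
  exact hc

end Iterated

/-! ### Definable sets of the translation structure -/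

section Definability

variable {α : Type} {N : ℕ}

theorem def_add (i j : α) : Def (shiftLang N) {v : α → ℕ | v j = v i + N} := by
  let R : (shiftLang N).Relations 2 := ShiftRel.shift
  refine (empty_definable_iff.mpr ⟨R.formula₂ (FirstOrder.Language.Term.var i)
    (FirstOrder.Language.Term.var j), ?_⟩).mono (empty_subset univ)
  ext v
  refine Iff.trans ?_ (FirstOrder.Language.Formula.realize_rel₂ (R := R) (v := v)
    (t₁ := FirstOrder.Language.Term.var i) (t₂ := FirstOrder.Language.Term.var j)).symm
  rfl

theorem def_add_mul [Finite α] (i j : α) (k : ℕ) :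
    Def (shiftLang N) {v : α → ℕ | v j = v i + N * k} := by
  induction k generalizing α with
  | zero => simpa using def_eq_var (L := shiftLang N) (M := ℕ) j i
  | succ k ih =>
    have h := ((ih (some i : Option α) none).inter (def_add none (some j))).image_comp
      (some : α → Option α)
    refine (congrArg (Def _) ?_).mp h
    ext v
    constructor
    · rintro ⟨w, ⟨h1, h2⟩, rfl⟩
      simp only [mem_ofPred_eq, Function.comp] at *
      rw [h2, h1, mul_add]
      ring
    · intro hv
      refine ⟨extend v (v i + N * k), ⟨rfl, ?_⟩, rfl⟩
      simp only [mem_ofPred_eq, extend, Option.elim] at *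
      rw [hv, mul_add]
      ring

theorem def_lt (i : α) (k : ℕ) : Def (shiftLang N) {v : α → ℕ | v i < k} := by
  induction k with
  | zero => simp
  | succ k ih =>
    refine (congrArg (Def _) ?_).mp (ih.union (def_eq_const i k))
    ext v
    simp only [mem_union, mem_ofPred_eq]
    omega

end Definability

/-! ### The Grothendieck ring of the translation structure -/

section Ring

variable {N : ℕ} {α : Type} [Finite α]

/-- The class of a definable set in the Grothendieck ring. -/
noncomputable def kcls (A : Set (α → ℕ)) (hA : Def (shiftLang N) A) : K0 (shiftLang N) ℕ :=
  GrothendieckRing.of (cls A hA)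

theorem kcls_congr {β : Type} [Finite β] {A : Set (α → ℕ)} {B : Set (β → ℕ)}
    {hA : Def (shiftLang N) A} {hB : Def (shiftLang N) B} (h : DefBij (shiftLang N) A B) :
    kcls A hA = kcls B hB :=
  congrArg _ (cls_eq h)

theorem kcls_union {A B C : Set (α → ℕ)} {hA : Def (shiftLang N) A} {hB : Def (shiftLang N) B}
    {hC : Def (shiftLang N) C} (hd : Disjoint A B) (e : A ∪ B = C) :
    kcls C hC = kcls A hA + kcls B hB := by
  subst e
  exact (congrArg _ (cls_add_of_disjoint hA hB hd).symm).trans (map_add _ _ _)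

theorem kcls_inter_add_diff {A B : Set (α → ℕ)} (hA : Def (shiftLang N) A)
    (hB : Def (shiftLang N) B) :
    kcls A hA = kcls (A ∩ B) (hA.inter hB) + kcls (A \ B) (hA.sdiff hB) :=
  kcls_union (disjoint_left.mpr fun _ h h' => h'.2 h.2) (inter_union_sdiff A B)

theorem kcls_empty : kcls (∅ : Set (α → ℕ)) definable_empty = (0 : K0 (shiftLang N) ℕ) :=
  (congrArg _ cls_empty).trans (map_zero _)

variable (N) in
/-- The class of the structure itself. -/
noncomputable def lineClass : K0 (shiftLang N) ℕ := kcls (univ : Set (Fin 1 → ℕ)) definable_univ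

theorem kcls_prod_univ {n : ℕ} {B : Set (Fin n → ℕ)} (hB : Def (shiftLang N) B) :
    kcls (prodSet B (univ : Set (Fin 1 → ℕ))) (def_prodSet hB definable_univ) =
      kcls B hB * lineClass N :=
  (congrArg _ (cls_mul hB definable_univ).symm).trans (map_mul _ _ _)

theorem lineClass_pow (n : ℕ) :
    lineClass N ^ n = kcls (univ : Set (Fin n → ℕ)) definable_univ := by
  induction n with
  | zero => exact (map_one GrothendieckRing.of).symm
  | succ n ih =>
    rw [pow_succ, ih, ← kcls_prod_univ]
    have h : DefBij (shiftLang N)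
        (prodSet (univ : Set (Fin n → ℕ)) (univ : Set (Fin 1 → ℕ))) _ :=
      defBij_reindex finSumFinEquiv.symm (def_prodSet definable_univ definable_univ)
    have e : reindex finSumFinEquiv.symm (prodSet (univ : Set (Fin n → ℕ))
        (univ : Set (Fin 1 → ℕ))) = univ := eq_univ_of_forall fun v => ⟨trivial, trivial⟩
    rw [e] at h
    exact kcls_congr h

theorem kcls_lt (k : ℕ) :
    kcls {v : Fin 1 → ℕ | v 0 < k} (def_lt 0 k) = (k : K0 (shiftLang N) ℕ) := by
  induction k with
  | zero =>
    rw [Nat.cast_zero, ← kcls_empty (α := Fin 1)]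
    congr 1
    exact eq_empty_of_forall_notMem fun v => Nat.not_lt_zero _
  | succ k ih =>
    have h1 : (1 : K0 (shiftLang N) ℕ) =
        kcls {v : Fin 1 → ℕ | v 0 = k} (def_eq_const 0 k) := by
      rw [← map_one GrothendieckRing.of]
      refine congrArg _ (cls_eq (hA := definable_univ) (defBij_of_coordMap (fun _ => .inr k)
        definable_univ ⟨fun _ _ => rfl, fun _ _ _ _ _ => Subsingleton.elim _ _, fun v hv => ?_⟩))
      refine ⟨Fin.elim0, trivial, funext fun i => ?_⟩
      rw [Subsingleton.elim i 0]
      exact hv.symm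
    rw [Nat.cast_succ, ← ih, h1]
    refine kcls_union (disjoint_left.mpr fun v h h' => ?_) ?_
    · simp only [mem_ofPred_eq] at h h'
      omega
    · ext v
      simp only [mem_union, mem_ofPred_eq]
      omega

/-- The translation is a definable bijection from the structure to the complement of `N` points. -/
theorem natCast_eq_zero : (N : K0 (shiftLang N) ℕ) = 0 := by
  have h2 : DefBij (shiftLang N) (univ : Set (Fin 1 → ℕ)) {v : Fin 1 → ℕ | v 0 < N}ᶜ := by
    refine ⟨fun (v : Fin 1 → ℕ) i => v i + N, ⟨fun v _ => ?_, fun v _ w _ h => ?_, fun v hv => ?_⟩,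
      ?_⟩
    · simp
    · ext i
      simpa using congrFun h i
    · simp only [mem_compl_iff, mem_ofPred_eq, not_lt] at hv
      refine ⟨fun i => v i - N, trivial, funext fun i => ?_⟩
      rw [Subsingleton.elim i 0]
      exact Nat.sub_add_cancel hv
    · refine (congrArg (Def _) ?_).mp (def_add (N := N) (Sum.inl 0 : Fin 1 ⊕ Fin 1) (.inr 0))
      ext w
      simp only [mem_ofPred_eq, mem_univ, true_and, funext_iff, Fin.forall_fin_one, Function.comp]
  have h3 : lineClass N = kcls {v : Fin 1 → ℕ | v 0 < N} (def_lt 0 N) +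
      kcls {v : Fin 1 → ℕ | v 0 < N}ᶜ (def_lt 0 N).compl :=
    kcls_union disjoint_compl_right (union_compl_self _)
  rw [kcls_lt, ← kcls_congr (hA := definable_univ) h2] at h3
  exact right_eq_add.mp h3

/-! ### Every class is a polynomial in the class of the structure -/

variable {n : ℕ} {T : Subring (K0 (shiftLang N) ℕ)}

/-- A definable set on which the projection to the first `n` variables is injective has the class
of its image. -/
theorem kcls_mem_of_injOn
    (ih : ∀ (A : Set (Fin n → ℕ)) (hA : Def (shiftLang N) A), kcls A hA ∈ T)
    {D : Set (Fin n ⊕ Fin 1 → ℕ)} (hD : Def (shiftLang N) D)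
    (hi : InjOn (fun w => w ∘ Sum.inl) D) : kcls D hD ∈ T := by
  have h : DefBij (shiftLang N) D ((fun w => w ∘ Sum.inl) '' D) :=
    defBij_of_coordMap (fun i => (.inl (.inl i) : (Fin n ⊕ Fin 1) ⊕ ℕ)) hD hi.bijOn_image
  rw [kcls_congr (hB := hD.image_comp _) h]
  exact ih _ _

theorem kcls_mem_of_subset_iUnion
    (ih : ∀ (A : Set (Fin n → ℕ)) (hA : Def (shiftLang N) A), kcls A hA ∈ T)
    {ι : Type*} {D : ι → Set (Fin n ⊕ Fin 1 → ℕ)} (hD : ∀ i, Def (shiftLang N) (D i))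
    (hi : ∀ i, InjOn (fun w => w ∘ Sum.inl) (D i)) (s : Finset ι)
    {Z : Set (Fin n ⊕ Fin 1 → ℕ)} (hZ : Def (shiftLang N) Z) (hs : Z ⊆ ⋃ i ∈ s, D i) :
    kcls Z hZ ∈ T := by
  classical
  induction s using Finset.induction_on generalizing Z with
  | empty =>
    obtain rfl : Z = ∅ := by simpa [subset_empty_iff] using hs
    rw [kcls_empty]
    exact T.zero_mem
  | insert i s _ ih' =>
    rw [kcls_inter_add_diff hZ (hD i)]
    refine T.add_mem (kcls_mem_of_injOn ih _ ((hi i).mono inter_subset_right)) (ih' _ ?_)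
    rintro w ⟨hw, hw'⟩
    have := hs hw
    simp only [Finset.mem_insert, mem_iUnion, exists_prop] at this ⊢
    obtain ⟨j, rfl | hj, h⟩ := this
    · exact (hw' h).elim
    · exact ⟨j, hj, h⟩

/-- Outside the graphs of finitely many translations and constants, membership in a definable set
does not depend on the last variable. -/
theorem exists_graphs (hN : 0 < N) {A : Set (Fin n ⊕ Fin 1 → ℕ)} (hA : Def (shiftLang N) A) :
    ∃ (ι : Type) (_ : Fintype ι) (D : ι → Set (Fin n ⊕ Fin 1 → ℕ)),
      (∀ i, Def (shiftLang N) (D i)) ∧ (∀ i, InjOn (fun w => w ∘ Sum.inl) (D i)) ∧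
      ∀ w w', w ∘ Sum.inl = w' ∘ Sum.inl → w ∉ ⋃ i, D i → w' ∉ ⋃ i, D i → w ∈ A → w' ∈ A := by
  obtain ⟨K, hK⟩ := isLocal_mem hA
  refine ⟨Fin K ⊕ (Fin n × Fin (K + 1)) ⊕ (Fin n × Fin (K + 1)), inferInstance,
    Sum.elim (fun a => {w | w (.inr 0) = a}) (Sum.elim
      (fun p => {w | w (.inr 0) = w (.inl p.1) + N * p.2})
      (fun p => {w | w (.inl p.1) = w (.inr 0) + N * p.2})), ?_, ?_, ?_⟩
  · rintro (a | p | p)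
    · exact def_eq_const _ _
    · exact def_add_mul _ _ _
    · exact def_add_mul _ _ _
  · have key : ∀ w w' : Fin n ⊕ Fin 1 → ℕ, w ∘ Sum.inl = w' ∘ Sum.inl →
        w (.inr 0) = w' (.inr 0) → w = w' := fun w w' h h' => by
      ext (i | i)
      · exact congrFun h i
      · rw [Subsingleton.elim i 0, h']
    rintro (a | p | p) w hw w' hw' h
    · exact key w w' h (hw.trans hw'.symm)
    · have := congrFun h p.1
      simp only [Sum.elim_inr, Sum.elim_inl, mem_ofPred_eq, Function.comp] at hw hw' this
      exact key w w' h (by omega)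
    · have := congrFun h p.1
      simp only [Sum.elim_inr, mem_ofPred_eq, Function.comp] at hw hw' this
      exact key w w' h (by omega)
  · intro w w' h hw hw'
    simp only [mem_iUnion, Sum.exists, Sum.elim_inl, Sum.elim_inr, mem_ofPred_eq, not_or,
      not_exists, Prod.forall] at hw hw'
    have small : ∀ z : Fin n ⊕ Fin 1 → ℕ, (∀ a : Fin K, ¬ z (.inr 0) = a) → ¬ z (.inr 0) < K :=
      fun z hz hlt => hz ⟨_, hlt⟩ rfl
    have far : ∀ z : Fin n ⊕ Fin 1 → ℕ,
        (∀ (i : Fin n) (k : Fin (K + 1)), ¬ z (.inr 0) = z (.inl i) + N * k) →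
        (∀ (i : Fin n) (k : Fin (K + 1)), ¬ z (.inl i) = z (.inr 0) + N * k) →
        ∀ i, ¬ Near N K (z (.inl i)) (z (.inr 0)) := by
      intro z h1 h2 i hi
      rcases le_total (z (.inl i)) (z (.inr 0)) with hle | hle
      · obtain ⟨k, hk, e⟩ := hi.exists_eq_add hN hle
        exact h1 i ⟨k, by omega⟩ e
      · obtain ⟨k, hk, e⟩ := hi.symm.exists_eq_add hN hle
        exact h2 i ⟨k, by omega⟩ e
    have e : ∀ i, w (.inl i) = w' (.inl i) := congrFun h
    have f1 := far w hw.2.1 hw.2.2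
    have f2 := far w' hw'.2.1 hw'.2.2
    refine (iff_of_eq (hK w w' ⟨?_, ?_⟩)).mp
    · rintro (i | i) hi
      · exact e i
      · rw [Subsingleton.elim i 0] at hi ⊢
        exact (hi.elim (small w hw.1) (small w' hw'.1)).elim
    · rintro (i | i) (j | j) hij
      · rw [e, e]
      · rw [Subsingleton.elim j 0] at hij
        exact (hij.elim (f1 i) (f2 i)).elim
      · rw [Subsingleton.elim i 0] at hij
        exact (hij.elim (fun h => f1 j h.symm) (fun h => f2 j h.symm)).elim
      · rw [Subsingleton.elim i j, sub_self, sub_self]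

/-- Cell decomposition: up to sets with injective projection, a definable set in `n + 1` variables
is a cylinder `B × M`. -/
theorem kcls_mem (hN : 0 < N) (hT : lineClass N ∈ T) (n : ℕ) (A : Set (Fin n → ℕ))
    (hA : Def (shiftLang N) A) : kcls A hA ∈ T := by
  induction n with
  | zero =>
    rcases A.eq_empty_or_nonempty with rfl | ⟨a, ha⟩
    · rw [kcls_empty]
      exact T.zero_mem
    · obtain rfl : A = univ := eq_univ_of_forall fun v => by rwa [Subsingleton.elim v a]
      rw [← lineClass_pow, pow_zero]
      exact T.one_mem
  | succ n ih =>
    suffices H : ∀ (A : Set (Fin n ⊕ Fin 1 → ℕ)) (hA : Def (shiftLang N) A), kcls A hA ∈ T by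
      let f : Fin n ⊕ Fin 1 ≃ Fin (n + 1) := finSumFinEquiv
      have hA' := hA.preimage_comp f.symm
      have h := defBij_reindex f.symm hA'
      have e : reindex f.symm ((fun v => v ∘ f.symm) ⁻¹' A) = A := by
        ext v
        simp [reindex, Function.comp_assoc]
      rw [e] at h
      rw [← kcls_congr (hA := hA') h]
      exact H _ hA'
    intro A hA
    obtain ⟨ι, _, D, hD, hi, hgen⟩ := exists_graphs hN hA
    have hU : Def (shiftLang N) (⋃ i, D i) := definable_iUnion_of_finite hD
    have hB := (hA.sdiff hU).image_comp (Sum.inl : Fin n → Fin n ⊕ Fin 1)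
    have hP := def_prodSet hB (definable_univ (M := ℕ) (α := Fin 1))
    set P := prodSet ((fun g : Fin n ⊕ Fin 1 → ℕ => g ∘ Sum.inl) '' (A \ ⋃ i, D i))
      (univ : Set (Fin 1 → ℕ))
    have hsub : ∀ {Z} (hZ : Def (shiftLang N) Z), kcls (Z ∩ ⋃ i, D i) (hZ.inter hU) ∈ T :=
      fun hZ => kcls_mem_of_subset_iUnion ih hD hi Finset.univ _
        (by simp)
    have e : kcls (A \ ⋃ i, D i) (hA.sdiff hU) = kcls (P \ ⋃ i, D i) (hP.sdiff hU) := by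
      congr 1
      ext w
      constructor
      · exact fun hw => ⟨⟨⟨w, hw, rfl⟩, trivial⟩, hw.2⟩
      · rintro ⟨⟨⟨w', hw', e⟩, -⟩, hw⟩
        exact ⟨hgen w' w e hw'.2 hw hw'.1, hw⟩
    have hPmem : kcls P hP ∈ T := by
      rw [kcls_prod_univ hB]
      exact T.mul_mem (ih _ _) hT
    rw [kcls_inter_add_diff hP hU] at hPmem
    rw [kcls_inter_add_diff hA hU, e]
    exact T.add_mem (hsub hA) ((T.add_mem_cancel_left (hsub hP)).mp hPmem)

/-! ### The isomorphism with the polynomial ring -/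

variable {R : Type*} [CommRing R]

/-- The Euler characteristic on the Grothendieck semiring. -/
noncomputable def eulerSemi (X : R) (hR : (N : R) = 0) (hN : 0 < N) :
    SemiK0 (shiftLang N) ℕ →+ R where
  toFun := Quotient.lift (fun A : DefSet (shiftLang N) ℕ => euler X (A.2 : Set (Fin A.1 → ℕ)))
    fun _ _ h => euler_eq_of_defBij hR hN h
  map_zero' := (euler_eq_of_defBij hR hN defBij_empty).trans (euler_empty 0)
  map_add' x y := by
    obtain ⟨n, A, hA, rfl⟩ := exists_cls x
    obtain ⟨m, B, hB, rfl⟩ := exists_cls y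
    have hl := def_leftCopy (β := Fin m) hA
    have hr := def_rightCopy (α := Fin n) hB
    rw [cls_add hA hB]
    let e := (Finite.equivFin (Option (Fin n ⊕ Fin m))).symm
    refine (euler_union (X := X) (def_reindex e hl) (def_reindex e hr) ?_).trans ?_
    · exact disjoint_left.mpr fun v h h' => disjoint_left.mp (disjoint_copies A B) h h'
    · congr 1
      · exact euler_eq_of_defBij hR hN ((defBij_reindex e hl).symm.trans
          ((defBij_leftCopy hA).symm.trans (defBij_reindex _ hA)))
      · exact euler_eq_of_defBij hR hN ((defBij_reindex e hr).symm.trans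
          ((defBij_rightCopy hB).symm.trans (defBij_reindex _ hB)))

/-- The Euler characteristic on the Grothendieck ring. Only its additivity is needed. -/
noncomputable def eulerHom (X : R) (hR : (N : R) = 0) (hN : 0 < N) :
    K0 (shiftLang N) ℕ →+ R :=
  GrothendieckRing.liftAdd (eulerSemi X hR hN)

theorem eulerHom_lineClass_pow (X : R) (hR : (N : R) = 0) (hN : 0 < N) (n : ℕ) :
    eulerHom X hR hN (lineClass N ^ n) = X ^ n := by
  rw [lineClass_pow, ← euler_univ (X := X)]
  refine (GrothendieckRing.liftAdd_ofAdd _ _).trans ?_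
  exact euler_eq_of_defBij hR hN (defBij_reindex (Finite.equivFin _).symm definable_univ).symm

variable (N) in
/-- The homomorphism that sends the variable to the class of the structure. -/
noncomputable def polyHom : Polynomial (ZMod N) →+* K0 (shiftLang N) ℕ :=
  Polynomial.eval₂RingHom (ZMod.castHom (ringChar.dvd natCast_eq_zero) _) (lineClass N)

theorem eulerHom_polyHom (hR : (N : Polynomial (ZMod N)) = 0) (hN : 0 < N)
    (p : Polynomial (ZMod N)) : eulerHom Polynomial.X hR hN (polyHom N p) = p := by
  refine DFunLike.congr_fun (f := (eulerHom Polynomial.X hR hN).comp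
    (polyHom N).toAddMonoidHom) (g := AddMonoidHom.id _) (Polynomial.addHom_ext fun n a => ?_) p
  have : NeZero N := ⟨hN.ne'⟩
  obtain ⟨k, rfl⟩ := ZMod.natCast_zmod_surjective (n := N) a
  change eulerHom Polynomial.X hR hN (polyHom N (Polynomial.monomial n (k : ZMod N))) =
    Polynomial.monomial n (k : ZMod N)
  rw [polyHom, Polynomial.coe_eval₂RingHom, Polynomial.eval₂_monomial, map_natCast,
    ← nsmul_eq_mul, map_nsmul, eulerHom_lineClass_pow, ← Polynomial.C_mul_X_pow_eq_monomial,
    nsmul_eq_mul, map_natCast]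

theorem polyHom_bijective (hN : 0 < N) : Function.Bijective (polyHom N) := by
  have hR : (N : Polynomial (ZMod N)) = 0 := by
    rw [← map_natCast Polynomial.C, ZMod.natCast_self, map_zero]
  refine ⟨Function.LeftInverse.injective (eulerHom_polyHom hR hN), ?_⟩
  have hX : lineClass N ∈ (polyHom N).range := ⟨Polynomial.X, Polynomial.eval₂_X _ _⟩
  intro x
  obtain ⟨a, b, rfl⟩ := GrothendieckRing.exists_sub x
  obtain ⟨n, A, hA, rfl⟩ := exists_cls a
  obtain ⟨m, B, hB, rfl⟩ := exists_cls b
  exact (polyHom N).range.sub_mem (kcls_mem hN hX n A hA) (kcls_mem hN hX m B hB)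

variable (N) in
/-- The Grothendieck ring of `(ℕ, x ↦ x + N)` is a polynomial ring over `ℤ/N`. -/
noncomputable def k0EquivPolynomial (hN : 0 < N) :
    K0 (shiftLang N) ℕ ≃+* Polynomial (ZMod N) :=
  (RingEquiv.ofBijective (polyHom N) (polyHom_bijective hN)).symm

end Ring

end ModelK0

theorem theorem1 :
    (∀ N : ℕ, 0 < N →
      ∃ (L : FirstOrder.Language.{0, 0}) (M : Type) (_ : L.Structure M) (_ : Nontrivial M),
        Nonempty (ModelK0.K0 L M ≃+* Polynomial (ZMod N))) ∧
    (∃ (L : FirstOrder.Language.{0, 0}) (M : Type) (_ : L.Structure M) (_ : Nontrivial M),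
      Nontrivial (ModelK0.K0 L M) ∧ ringChar (ModelK0.K0 L M) ≠ 0) := by
  refine ⟨fun N hN => ⟨ModelK0.shiftLang N, ℕ, inferInstance, inferInstance,
    ⟨ModelK0.k0EquivPolynomial N hN⟩⟩,
    ModelK0.shiftLang 2, ℕ, inferInstance, inferInstance, ?_, fun h => ?_⟩
  · exact (ModelK0.k0EquivPolynomial 2 two_pos).toEquiv.nontrivial
  · have := ringChar.dvd (ModelK0.natCast_eq_zero (N := 2))
    rw [h] at this
    omega
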